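/- Let $M$ be a finite-dimensional smooth manifold without boundary (Hausdorff, second countable). For a smooth curve $\gamma$ in a manifold $N$, write $\gamma'$ for its tangent, a curve in $TN$. Let $E_1\in\mathfrak X(TM)$, $E_1(\xi)=\partial_s((1+s)\xi)|_{s=0}$, be the Liouville vector field, and let $S$ be a spray on $M$, i.e. a smooth vector field on $TM\setminus 0$ with $D\pi\circ S=\mathrm{id}$ (where $\pi\colon TM\to M$) and $[E_1,S]=S$. For a manifold $N$ let $\kappa\colon TTN\to TTN$ be the canonical involution, $\kappa(x,y,X,Y)=(x,X,y,Y)$ in induced coordinates; write $\kappa_2$ for it when $N=M$, $\kappa_3$ when $N=TM$, $\kappa_4$ when $N=TTM$. The complete lift of $S$ is $S^c=D\kappa_2\circ\kappa_3\circ DS\circ\kappa_2$, and the complete lift of $S^c$ is $S^{cc}=D\kappa_3\circ\kappa_4\circ DS^c\circ\kappa_3$, which is defined on the set of $\xi\in TTTM$ with $D\pi_{TTM\to M}(\xi)\neq0$. A smooth curve $c$ in $M$ is a geodesic of $S$ if $c'$ never vanishes and $c''=S\circ c'$; a smooth curve $\gamma$ in $TTM$ is a geodesic of $S^{cc}$ if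 $(\pi_{TTM\to M}\circ\gamma)'$ never vanishes and $\gamma''=S^{cc}\circ\gamma'$. A curve $J\colon I\to TM$ is a parallel Jacobi field for $S$ if $J(t)=\alpha c'(t)+\beta t\,c'(t)$ for all $t\in I$, for some geodesic $c\colon I\to M$ of $S$ and some $\alpha,\beta\in\mathbb R$. Let $$\Delta=\{(\kappa_2\circ J')'(0) : \varepsilon>0,\ J\colon(-\varepsilon,\varepsilon)\to TM \text{ a parallel Jacobi field for } S\}\subset TTTM,$$ and $P=(S^{cc},TTM,\Delta)$. A curve $\gamma\colon I\to TTM$ is a geodesic in $P$ if it is a geodesic of $S^{cc}$ and $\gamma'(t_0)\in\Delta$ for some $t_0\in I$. **Proposition.** Let $I\subset\mathbb R$ be an open interval containing $0$ and let $\gamma\colon I\to TTM$ be a smooth curve. The following are equivalent: 1. $\gamma$ is a geodesic in $P$. 2. There is a parallel Jacobi field $J\colon I\to TM$ for $S$ such that $\gamma(t)=\kappa_2(J'(t))$ for all $t\in I$. 3. There are a geodesic $c\colon I\to M$ of $S$ and $\alpha,\beta\in\mathbb R$ such that $\gamma(t)=(\alpha+\beta t)\,c''(t)+\beta\,E_1(c'(t))$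 for all $t\in I$, the sum being taken in $T_{c'(t)}TM$. Moreover, the field $J$ in (2), and the geodesic $c$ and the constants $\alpha,\beta$ representing it, are uniquely determined by $\gamma$, and so are $c,\alpha,\beta$ in (3). -/

import Mathlib

open scoped Manifold ContDiff
open Bundle Set

noncomputable section

namespace SprayGeometry

variable {E : Type*} [NormedAddCommGroup E] [NormedSpace ℝ E]
  {H : Type*} [TopologicalSpace H] {I : ModelWithCorners ℝ E H}
  {N : Type*} [TopologicalSpace N] [ChartedSpace H N]

/-- The tangent bundle of a smooth manifold is a smooth manifold. -/
instance tangentBundle_isManifold [IsManifold I ∞ N] :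
    IsManifold I.tangent ∞ (TangentBundle I N) := by
  have h : IsManifold I (∞ + 1) N := ‹IsManifold I ∞ N›
  exact Bundle.TotalSpace.isManifold E (TangentSpace I)

variable (I N) in
/-- The second iterated tangent bundle `TTN`. -/
abbrev TT [IsManifold I ∞ N] : Type _ :=
  TangentBundle I.tangent (TangentBundle I N)

variable (I N) in
/-- The third iterated tangent bundle `TTTN`. -/
abbrev TTT [IsManifold I ∞ N] : Type _ :=
  TangentBundle I.tangent.tangent (TT I N)

/-- The tangent `γ'` of a curve `γ` in `N`, as a curve in `TN`. -/
def velocity (γ : ℝ → N) (t : ℝ) : TangentBundle I N :=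
  ⟨γ t, mfderiv 𝓘(ℝ, ℝ) I γ t (1 : ℝ)⟩

/-- The canonical involution `κ` of `TTN`: in the coordinates `(x, y, X, Y)` of `TTN` induced by a
chart of `N` it is the map `(x, y, X, Y) ↦ (x, X, y, Y)`. -/
def involution [IsManifold I ∞ N] (ξ : TT I N) : TT I N :=
  let φ := extChartAt I.tangent.tangent ξ
  φ.symm (((φ ξ).1.1, (φ ξ).2.1), ((φ ξ).1.2, (φ ξ).2.2))

/-- The value at `ξ ∈ TN` of the Liouville vector field, `∂ₛ ((1 + s) ξ)` at `s = 0`.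
The curve passes through `ξ` at `s = 0`, so that its derivative is a tangent vector at `ξ`. -/
def liouville [IsManifold I ∞ N] (ξ : TangentBundle I N) : TangentSpace I.tangent ξ :=
  mfderiv 𝓘(ℝ, ℝ) I.tangent (fun s : ℝ => (⟨ξ.1, (1 + s) • ξ.2⟩ : TangentBundle I N)) 0 (1 : ℝ)

theorem liouville_eq_velocity [IsManifold I ∞ N] (ξ : TangentBundle I N) :
    (⟨ξ, liouville ξ⟩ : TT I N) =
      velocity (fun s : ℝ => (⟨ξ.1, (1 + s) • ξ.2⟩ : TangentBundle I N)) 0 := by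
  refine Bundle.TotalSpace.ext ?_ HEq.rfl
  simp [velocity]

section Slashed

variable {E₀ : Type*} [NormedAddCommGroup E₀] [NormedSpace ℝ E₀]
  {H₀ : Type*} [TopologicalSpace H₀] (I₀ : ModelWithCorners ℝ E₀ H₀)
  {M : Type*} [TopologicalSpace M] [ChartedSpace H₀ M]

/-- The slashed tangent bundle of a manifold `N` over `M`, where `p : N → M` is the projection of
the iterated tangent bundle `N = TʳM` onto `M` (the identity for `r = 0`): the vectors `ξ ∈ TN`
such that `Dp ξ` is a nonzero vector of `TM`. -/
def slashed (I : ModelWithCorners ℝ E H) (p : N → M) : Set (TangentBundle I N) :=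
  {ξ | (tangentMap I I₀ p ξ).2 ≠ 0}

/-- A curve `γ : s → N`, where `p : N = TʳM → M` is the projection, is a geodesic of `S` if it is
smooth and regular on `s` and `γ'' = S ∘ γ'` there. Only the values of `S` on the slashed tangent
bundle matter. -/
structure IsGeodesic [IsManifold I ∞ N] (p : N → M) (S : TangentBundle I N → TT I N)
    (s : Set ℝ) (γ : ℝ → N) : Prop where
  smooth : ContMDiffOn 𝓘(ℝ, ℝ) I ∞ γ s
  regular : ∀ t ∈ s, velocity γ t ∈ slashed I₀ I p
  equation : ∀ t ∈ s, velocity (velocity γ) t = S (velocity γ t)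

/-- A curve is a geodesic in the restriction of the spray `S` to `Δ ⊆ TN` if it is a geodesic
of `S` whose tangent lies in `Δ` for some parameter value. -/
def IsRestrictedGeodesic [IsManifold I ∞ N] (p : N → M) (S : TangentBundle I N → TT I N)
    (Δ : Set (TangentBundle I N)) (s : Set ℝ) (γ : ℝ → N) : Prop :=
  IsGeodesic I₀ p S s γ ∧ ∃ t₀ ∈ s, velocity γ t₀ ∈ Δ

end Slashed

variable (I N) in
/-- A spray on `N`: a smooth vector field `S` on `TN ∖ 0` with `Dπ ∘ S = id` and `[E, S] = S`,
where `E` is the Liouville vector field. The values on the zero section are irrelevant. -/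
structure Spray [IsManifold I ∞ N] where
  toFun : (y : TangentBundle I N) → TangentSpace I.tangent y
  smooth : ContMDiffOn I.tangent I.tangent.tangent ∞
    (fun y => (⟨y, toFun y⟩ : TT I N)) (slashed I I (id : N → N))
  projection : ∀ y ∈ slashed I I (id : N → N),
    tangentMap I.tangent I (TotalSpace.proj : TangentBundle I N → N) ⟨y, toFun y⟩ = y
  homogeneous : ∀ y ∈ slashed I I (id : N → N),
    VectorField.mlieBracket I.tangent liouville toFun y = toFun y

/-- The spray as a map `TN → TTN`. -/
def Spray.toMap [IsManifold I ∞ N] (S : Spray I N) (y : TangentBundle I N) : TT I N :=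
  ⟨y, S.toFun y⟩

/-- The complete lift `Sᶜ = Dκ ∘ κ ∘ DS ∘ κ`, as a map `TTN → TTTN`; here the rightmost and the
leftmost `κ` are the involution of `TTN`, the other one is the involution of `TT(TN)`. -/
def completeLift [IsManifold I ∞ N] (S : TangentBundle I N → TT I N) (ξ : TT I N) :
    TTT I N :=
  tangentMap I.tangent.tangent I.tangent.tangent (involution (I := I) (N := N))
    (involution (I := I.tangent) (N := TangentBundle I N)
      (tangentMap I.tangent I.tangent.tangent S (involution ξ)))

/-- `c : s → N` is a geodesic of the spray `S` on `N`. -/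
def Spray.Geodesic [IsManifold I ∞ N] (S : Spray I N) (s : Set ℝ) (c : ℝ → N) : Prop :=
  IsGeodesic I (id : N → N) S.toMap s c

/-- The vector field `t ↦ α c'(t) + β t c'(t)` along `c`. -/
def parallelField (c : ℝ → N) (α β t : ℝ) : TangentBundle I N :=
  ⟨c t, α • (velocity (I := I) c t).2 + (β * t) • (velocity (I := I) c t).2⟩

/-- `J : s → TN` is a parallel Jacobi field for `S`. -/
def Spray.IsParallelJacobiField [IsManifold I ∞ N] (S : Spray I N) (s : Set ℝ)
    (J : ℝ → TangentBundle I N) : Prop :=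
  ∃ (α β : ℝ) (c : ℝ → N), S.Geodesic s c ∧ ∀ t ∈ s, J t = parallelField c α β t

/-- The set `Δ ⊆ TTTN` of the vectors `(κ₂ ∘ J')'(0)`, for parallel Jacobi fields
`J : (-ε, ε) → TN`. -/
def Spray.parallelSet [IsManifold I ∞ N] (S : Spray I N) : Set (TTT I N) :=
  {ξ | ∃ ε : ℝ, 0 < ε ∧ ∃ J : ℝ → TangentBundle I N,
    S.IsParallelJacobiField (Ioo (-ε) ε) J ∧
      ξ = velocity (fun t => involution (velocity J t)) 0}

/-- The projection `TTN → N`. -/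
def projTT [IsManifold I ∞ N] (ξ : TT I N) : N := ξ.1.1

/-- `γ : s → TTN` is a geodesic in `P = (Sᶜᶜ, TTN, Δ)`. -/
def Spray.IsGeodesicInP [IsManifold I ∞ N] (S : Spray I N) (s : Set ℝ)
    (γ : ℝ → TT I N) : Prop :=
  IsRestrictedGeodesic I projTT (completeLift (completeLift S.toMap)) S.parallelSet s γ

/-- The curve `t ↦ (α + β t) c''(t) + β E₁(c'(t))` in `TTN`; the sum is taken in the tangent space
of `TN` at `c'(t)`. -/
def secondOrderCurve [IsManifold I ∞ N] (c : ℝ → N) (α β t : ℝ) : TT I N :=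
  let v : TangentSpace I.tangent (velocity (I := I) c t) :=
    (velocity (I := I.tangent) (velocity (I := I) c) t).2
  ⟨velocity c t, (α + β * t) • v + β • liouville (velocity (I := I) c t)⟩

end SprayGeometry

end

noncomputable section

open Filter
open scoped Topology

namespace SprayGeometry

/-! ### Charts of the tangent bundle, velocities of curves and of two-parameter families. -/

section Basic

variable {E : Type*} [NormedAddCommGroup E] [NormedSpace ℝ E]
  {H : Type*} [TopologicalSpace H] {I : ModelWithCorners ℝ E H}
  {N : Type*} [TopologicalSpace N] [ChartedSpace H N]
  {E' : Type*} [NormedAddCommGroup E'] [NormedSpace ℝ E']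
  {H' : Type*} [TopologicalSpace H'] {I' : ModelWithCorners ℝ E' H'}
  {N' : Type*} [TopologicalSpace N'] [ChartedSpace H' N']
  {E'' : Type*} [NormedAddCommGroup E''] [NormedSpace ℝ E'']
  {H'' : Type*} [TopologicalSpace H''] {I'' : ModelWithCorners ℝ E'' H''}
  {N'' : Type*} [TopologicalSpace N''] [ChartedSpace H'' N'']
  {V : Type*} [NormedAddCommGroup V] [NormedSpace ℝ V]

/-! Everything comes from one variation of a geodesic c by affine reparametrisations, F(s, t) = c((1
+ βs)t + αs) (`affineVariation`). Its variation field ∂ₛF at s = 0 is the parallel Jacobi field J =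
(α + βt)c'. Since κ exchanges the order of differentiation, κ(J') is ∂ₛ∂ₜF at s = 0, and the chain
rule evaluates this as (α + βt)c'' + βE₁(c'). So (2) and (3) are the same condition
(`involution_velocity_parallelField`).

The condition [E₁, S] = S is Euler's relation along rays. Hence S is positively homogeneous
(`Spray.toMap_fiberSmul`), and t ↦ F(s, t) is a geodesic as long as 1 + βs > 0. Tangents of
geodesics are geodesics of the complete lift (`velocity_velocity_velocity`), and so are variation
fields of families of geodesics (`velocitySnd_velocitySnd_velocityFst`). The first fact applied to t
↦ F(s, t) and the second to ∂ₜF make ∂ₛ∂ₜF at s = 0 a geodesic of Sᶜᶜ. Its velocity at 0 lies in Δ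
by construction, so (3) implies (1).

Conversely, let γ'(t₀) ∈ Δ come from a parallel Jacobi field along b with constants α, β. Geodesics
of Sᶜᶜ project to geodesics of S, so the projection c of γ is a geodesic on the whole interval; by
uniqueness it agrees near t₀ with b delayed by t₀. Thus γ and the curve (3) of c with constants α −
βt₀ and β have the same velocity at t₀, and uniqueness for Sᶜᶜ (`eqOn_velocity_of_eq`) makes them
equal.

For the uniqueness statements, c is the base curve of γ. Moreover Dπ sends c'' to c' ≠ 0 and kills
E₁, which yields α and then β. -/

instance tangent_boundaryless [I.Boundaryless] : I.tangent.Boundaryless :=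
  inferInstanceAs (I.prod 𝓘(ℝ, E)).Boundaryless

/-- The trivialization at `ξ.1` is fibrewise the differential of the base chart. This turns bundle
charts into derivatives. -/
theorem extChartAt_tangent_apply [IsManifold I ∞ N] {ξ η : TangentBundle I N}
    (h : η.1 ∈ (chartAt H ξ.1).source) :
    extChartAt I.tangent ξ η =
      (extChartAt I ξ.1 η.1, mfderiv I 𝓘(ℝ, E) (extChartAt I ξ.1) η.1 η.2) := by
  rw [ModelWithCorners.tangent, FiberBundle.extChartAt]
  simp only [PartialEquiv.coe_trans, Function.comp_apply, PartialEquiv.prod_coe,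
    PartialEquiv.refl_coe, id]
  refine Prod.ext rfl ?_
  have h1 := congrArg (fun L : E →L[ℝ] E => L η.2)
    (TangentBundle.continuousLinearMapAt_trivializationAt (I := I) h)
  refine Eq.trans ?_ h1
  change _ = Trivialization.continuousLinearMapAt ℝ (trivializationAt E (TangentSpace I) ξ.1) η.1 η.2
  rw [Trivialization.continuousLinearMapAt_apply, Trivialization.coe_linearMapAt_of_mem]
  · rfl
  · exact h

theorem extChartAt_tangent_source (ξ : TangentBundle I N) [IsManifold I ∞ N] :
    (extChartAt I.tangent ξ).source = {η | η.1 ∈ (chartAt H ξ.1).source} := by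
  rw [extChartAt_source]
  ext η
  exact TangentBundle.mem_chart_source_iff _ _

/-- The chart of `TN` at a vector only depends on the base point. -/
theorem extChartAt_tangent_congr [IsManifold I ∞ N] {ξ η : TangentBundle I N} (h : ξ.1 = η.1) :
    extChartAt I.tangent ξ = extChartAt I.tangent η := by
  rw [ModelWithCorners.tangent, FiberBundle.extChartAt, FiberBundle.extChartAt, h]

section Velocity

theorem velocity_congr {γ γ' : ℝ → N} {t : ℝ} (h : γ =ᶠ[𝓝 t] γ') :
    velocity (I := I) γ t = velocity γ' t := by
  unfold velocity
  rw [h.mfderiv_eq, h.eq_of_nhds]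

theorem velocity_comp {f : N → N'} {γ : ℝ → N} {t : ℝ} (hf : MDifferentiableAt I I' f (γ t))
    (hγ : MDifferentiableAt 𝓘(ℝ, ℝ) I γ t) :
    velocity (fun t => f (γ t)) t = tangentMap I I' f (velocity γ t) := by
  have := mfderiv_comp t hf hγ
  unfold velocity tangentMap
  exact congrArg (fun L : ℝ →L[ℝ] E' => (⟨f (γ t), L 1⟩ : TangentBundle I' N')) this

theorem velocity_comp_curve {F : V → N} {γ : ℝ → V} {γ' : V} {t : ℝ}
    (hF : MDifferentiableAt 𝓘(ℝ, V) I F (γ t)) (hγ : HasDerivAt γ γ' t) :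
    velocity (fun t => F (γ t)) t = tangentMap 𝓘(ℝ, V) I F ⟨γ t, γ'⟩ := by
  rw [velocity_comp (I := 𝓘(ℝ, V)) hF hγ.differentiableAt.mdifferentiableAt]
  congr 1
  unfold velocity
  rw [mfderiv_eq_fderiv]
  congr 1
  change fderiv ℝ γ t 1 = γ'
  simp [hγ.deriv]

end Velocity

/-! ### Smoothness on a neighbourhood, a notion stable under differentiation. -/

section SmoothNear

variable (I I') in
/-- Smoothness on a neighbourhood of a point. -/
def SmoothNear (f : N → N') (x : N) : Prop :=
  ∀ᶠ y in 𝓝 x, ContMDiffAt I I' ∞ f y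

variable {f : N → N'} {g : N' → N''} {x : N}

theorem SmoothNear.contMDiffAt (h : SmoothNear I I' f x) : ContMDiffAt I I' ∞ f x :=
  h.self_of_nhds

theorem SmoothNear.mdifferentiableAt (h : SmoothNear I I' f x) : MDifferentiableAt I I' f x :=
  h.contMDiffAt.mdifferentiableAt (by simp)

theorem SmoothNear.eventually (h : SmoothNear I I' f x) : ∀ᶠ y in 𝓝 x, SmoothNear I I' f y :=
  eventually_eventually_nhds.2 h

theorem SmoothNear.congr {f' : N → N'} (h : SmoothNear I I' f x) (h' : f' =ᶠ[𝓝 x] f) :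
    SmoothNear I I' f' x := by
  filter_upwards [h, eventually_eventually_nhds.2 h'] with y hy hy'
  exact hy.congr_of_eventuallyEq hy'

theorem SmoothNear.comp (hg : SmoothNear I' I'' g (f x)) (hf : SmoothNear I I' f x) :
    SmoothNear I I'' (fun y => g (f y)) x := by
  filter_upwards [hf, hf.contMDiffAt.continuousAt.eventually hg] with y hy hy'
  exact hy'.comp y hy

theorem ContMDiffOn.smoothNear {s : Set N} (h : ContMDiffOn I I' ∞ f s) (hs : IsOpen s)
    (hx : x ∈ s) : SmoothNear I I' f x := by
  filter_upwards [hs.mem_nhds hx] with y hy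
  exact h.contMDiffAt (hs.mem_nhds hy)

theorem ContMDiff.smoothNear (h : ContMDiff I I' ∞ f) : SmoothNear I I' f x :=
  Eventually.of_forall fun y => h y

/-- `ContMDiffAt` of order ∞ at one point only provides neighbourhoods depending on the finite
order. One open set of smoothness lets the differential be treated as a `tangentMapWithin`, again
smooth to order ∞. -/
theorem SmoothNear.tangentMap [IsManifold I ∞ N] [IsManifold I' ∞ N'] {ξ : TangentBundle I N}
    (h : SmoothNear I I' f ξ.1) :
    SmoothNear I.tangent I'.tangent (tangentMap I I' f) ξ := by
  obtain ⟨U, hU, hUo, hx⟩ := eventually_nhds_iff.1 h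
  have h1 : ContMDiffOn I I' ∞ f U := fun y hy => (hU y hy).contMDiffWithinAt
  have h2 := h1.contMDiffOn_tangentMapWithin (m := ∞) (by simp) hUo.uniqueMDiffOn
  refine ContMDiffOn.smoothNear (s := TotalSpace.proj ⁻¹' U) (h2.congr fun η hη => ?_)
    (hUo.preimage (FiberBundle.continuous_proj E (TangentSpace I))) hx
  exact (tangentMapWithin_eq_tangentMap (hUo.uniqueMDiffOn _ hη)
    ((hU _ hη).mdifferentiableAt (by simp))).symm

theorem smoothNear_extChartAt_symm [I.Boundaryless] [IsManifold I ∞ N] {x : N} {y : E}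
    (hy : y ∈ (extChartAt I x).target) : SmoothNear 𝓘(ℝ, E) I (extChartAt I x).symm y :=
  ContMDiffOn.smoothNear (contMDiffOn_extChartAt_symm x) (isOpen_extChartAt_target x) hy

theorem smoothNear_extChartAt [IsManifold I ∞ N] {x y : N}
    (hy : y ∈ (extChartAt I x).source) : SmoothNear I 𝓘(ℝ, E) (extChartAt I x) y := by
  refine ContMDiffOn.smoothNear (s := (chartAt H x).source) contMDiffOn_extChartAt
    (chartAt H x).open_source ?_
  rwa [extChartAt_source] at hy

end SmoothNear

/-! ### Partial velocities of two-parameter families. -/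

section Partial

/-- The velocity in the first variable of a two-parameter family. -/
def velocityFst (F : ℝ × ℝ → N) (q : ℝ × ℝ) : TangentBundle I N :=
  velocity (fun s => F (s, q.2)) q.1

/-- The velocity in the second variable of a two-parameter family. -/
def velocitySnd (F : ℝ × ℝ → N) (q : ℝ × ℝ) : TangentBundle I N :=
  velocity (fun t => F (q.1, t)) q.2

variable {F : ℝ × ℝ → N} {q : ℝ × ℝ}

theorem velocityFst_eq_tangentMap (hF : MDifferentiableAt 𝓘(ℝ, ℝ × ℝ) I F q) :
    velocityFst F q = tangentMap 𝓘(ℝ, ℝ × ℝ) I F ⟨q, ((1 : ℝ), (0 : ℝ))⟩ :=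
  velocity_comp_curve (γ := fun s => (s, q.2)) hF
    ((hasDerivAt_id q.1).prodMk (hasDerivAt_const q.1 q.2))

theorem velocitySnd_eq_tangentMap (hF : MDifferentiableAt 𝓘(ℝ, ℝ × ℝ) I F q) :
    velocitySnd F q = tangentMap 𝓘(ℝ, ℝ × ℝ) I F ⟨q, ((0 : ℝ), (1 : ℝ))⟩ :=
  velocity_comp_curve (γ := fun t => (q.1, t)) hF
    ((hasDerivAt_const q.2 q.1).prodMk (hasDerivAt_id q.2))

theorem contMDiff_constVector (v : V) :
    ContMDiff 𝓘(ℝ, V) 𝓘(ℝ, V).tangent ∞ (fun q : V => (⟨q, v⟩ : TangentBundle 𝓘(ℝ, V) V)) :=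
  (contMDiff_vectorSpace_iff_contDiff (V := fun _ : V => v)).2 contDiff_const

theorem SmoothNear.tangentMap_const [IsManifold I ∞ N] {F : V → N} {q : V}
    (hF : SmoothNear 𝓘(ℝ, V) I F q) (v : V) :
    SmoothNear 𝓘(ℝ, V) I.tangent (fun q => _root_.tangentMap 𝓘(ℝ, V) I F ⟨q, v⟩) q :=
  SmoothNear.comp (f := fun q : V => (⟨q, v⟩ : TangentBundle 𝓘(ℝ, V) V))
    (hF.tangentMap (ξ := (⟨q, v⟩ : TangentBundle 𝓘(ℝ, V) V)))
    (ContMDiff.smoothNear (contMDiff_constVector v))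

theorem SmoothNear.velocityFst [IsManifold I ∞ N] (hF : SmoothNear 𝓘(ℝ, ℝ × ℝ) I F q) :
    SmoothNear 𝓘(ℝ, ℝ × ℝ) I.tangent (SprayGeometry.velocityFst (I := I) F) q :=
  (hF.tangentMap_const _).congr <| hF.eventually.mono fun _ h =>
    velocityFst_eq_tangentMap h.mdifferentiableAt

theorem SmoothNear.velocitySnd [IsManifold I ∞ N] (hF : SmoothNear 𝓘(ℝ, ℝ × ℝ) I F q) :
    SmoothNear 𝓘(ℝ, ℝ × ℝ) I.tangent (SprayGeometry.velocitySnd (I := I) F) q :=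
  (hF.tangentMap_const _).congr <| hF.eventually.mono fun _ h =>
    velocitySnd_eq_tangentMap h.mdifferentiableAt

theorem SmoothNear.velocity [IsManifold I ∞ N] {γ : ℝ → N} {t : ℝ}
    (hγ : SmoothNear 𝓘(ℝ, ℝ) I γ t) : SmoothNear 𝓘(ℝ, ℝ) I.tangent (SprayGeometry.velocity (I := I) γ) t :=
  (hγ.tangentMap_const (1 : ℝ)).congr <| Eventually.of_forall fun _ => rfl

theorem SmoothNear.slice_fst (hF : SmoothNear 𝓘(ℝ, ℝ × ℝ) I F q) :
    SmoothNear 𝓘(ℝ, ℝ) I (fun s => F (s, q.2)) q.1 :=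
  SmoothNear.comp (f := fun s : ℝ => (s, q.2)) hF
    (ContMDiff.smoothNear (contDiff_id.prodMk contDiff_const).contMDiff)

theorem SmoothNear.slice_snd (hF : SmoothNear 𝓘(ℝ, ℝ × ℝ) I F q) :
    SmoothNear 𝓘(ℝ, ℝ) I (fun t => F (q.1, t)) q.2 :=
  SmoothNear.comp (f := fun t : ℝ => (q.1, t)) hF
    (ContMDiff.smoothNear (contDiff_const.prodMk contDiff_id).contMDiff)

theorem eventually_slice_fst {p : ℝ × ℝ → Prop} (h : ∀ᶠ q' in 𝓝 q, p q') :
    ∀ᶠ s in 𝓝 q.1, p (s, q.2) :=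
  ((Continuous.prodMk_left q.2).continuousAt (x := q.1)).eventually h

theorem eventually_slice_snd {p : ℝ × ℝ → Prop} (h : ∀ᶠ q' in 𝓝 q, p q') :
    ∀ᶠ t in 𝓝 q.2, p (q.1, t) :=
  ((Continuous.prodMk_right q.1).continuousAt (x := q.2)).eventually h

theorem velocityFst_congr {F' : ℝ × ℝ → N} (h : F =ᶠ[𝓝 q] F') :
    velocityFst (I := I) F q = velocityFst F' q :=
  velocity_congr (eventually_slice_fst h)

theorem velocitySnd_congr {F' : ℝ × ℝ → N} (h : F =ᶠ[𝓝 q] F') :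
    velocitySnd (I := I) F q = velocitySnd F' q :=
  velocity_congr (eventually_slice_snd h)

theorem velocityFst_comp {f : N → N'} (hf : MDifferentiableAt I I' f (F q))
    (hF : SmoothNear 𝓘(ℝ, ℝ × ℝ) I F q) :
    velocityFst (fun q => f (F q)) q = tangentMap I I' f (velocityFst F q) :=
  velocity_comp (γ := fun s => F (s, q.2)) hf hF.slice_fst.mdifferentiableAt

theorem velocitySnd_comp {f : N → N'} (hf : MDifferentiableAt I I' f (F q))
    (hF : SmoothNear 𝓘(ℝ, ℝ × ℝ) I F q) :
    velocitySnd (fun q => f (F q)) q = tangentMap I I' f (velocitySnd F q) :=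
  velocity_comp (γ := fun t => F (q.1, t)) hf hF.slice_snd.mdifferentiableAt

end Partial

end Basic

theorem two_le_infty : (2 : WithTop ℕ∞) ≤ ∞ :=
  WithTop.coe_le_coe.2 (le_top : (2 : ℕ∞) ≤ ⊤)

/-! ### The canonical involution as exchange of derivatives. -/

section Involution

variable {E : Type*} [NormedAddCommGroup E] [NormedSpace ℝ E]
  {H : Type*} [TopologicalSpace H] {I : ModelWithCorners ℝ E H}
  {N : Type*} [TopologicalSpace N] [ChartedSpace H N]
  {V : Type*} [NormedAddCommGroup V] [NormedSpace ℝ V]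

/-- The derivative of `F` in the direction `v`, as a map into the tangent bundle. -/
def dirVelocity (v : V) (F : V → N) (q : V) : TangentBundle I N :=
  tangentMap 𝓘(ℝ, V) I F ⟨q, v⟩

theorem dirVelocity_congr {v : V} {F F' : V → N} {q : V} (h : F =ᶠ[𝓝 q] F') :
    dirVelocity (I := I) v F q = dirVelocity v F' q := by
  unfold dirVelocity tangentMap
  simp only
  rw [h.mfderiv_eq, h.eq_of_nhds]

theorem velocityFst_velocitySnd {F : ℝ × ℝ → N} {q : ℝ × ℝ} [IsManifold I ∞ N]
    (hF : SmoothNear 𝓘(ℝ, ℝ × ℝ) I F q) :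
    velocityFst (I := I.tangent) (velocitySnd (I := I) F) q =
      dirVelocity ((1 : ℝ), (0 : ℝ)) (dirVelocity ((0 : ℝ), (1 : ℝ)) F) q := by
  rw [velocityFst_eq_tangentMap hF.velocitySnd.mdifferentiableAt]
  exact dirVelocity_congr <| hF.eventually.mono fun q hq =>
    velocitySnd_eq_tangentMap hq.mdifferentiableAt

theorem velocitySnd_velocityFst {F : ℝ × ℝ → N} {q : ℝ × ℝ} [IsManifold I ∞ N]
    (hF : SmoothNear 𝓘(ℝ, ℝ × ℝ) I F q) :
    velocitySnd (I := I.tangent) (velocityFst (I := I) F) q =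
      dirVelocity ((0 : ℝ), (1 : ℝ)) (dirVelocity ((1 : ℝ), (0 : ℝ)) F) q := by
  rw [velocitySnd_eq_tangentMap hF.velocityFst.mdifferentiableAt]
  exact dirVelocity_congr <| hF.eventually.mono fun q hq =>
    velocityFst_eq_tangentMap hq.mdifferentiableAt

variable [IsManifold I ∞ N]

theorem SmoothNear.dirVelocity {v : V} {F : V → N} {q : V} (hF : SmoothNear 𝓘(ℝ, V) I F q) :
    SmoothNear 𝓘(ℝ, V) I.tangent (SprayGeometry.dirVelocity (I := I) v F) q :=
  hF.tangentMap_const v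

theorem extChartAt_dirVelocity {ξ : TangentBundle I N} {v : V} {F : V → N} {q : V}
    (hF : MDifferentiableAt 𝓘(ℝ, V) I F q) (h : F q ∈ (chartAt H ξ.1).source) :
    extChartAt I.tangent ξ (dirVelocity v F q) =
      (extChartAt I ξ.1 (F q), fderiv ℝ (fun q => extChartAt I ξ.1 (F q)) q v) := by
  rw [extChartAt_tangent_apply (show (dirVelocity (I := I) v F q).1 ∈ _ from h)]
  have h2 := mfderiv_comp q (mdifferentiableAt_extChartAt (I := I) h) hF
  refine Prod.ext rfl ?_
  change mfderiv I 𝓘(ℝ, E) (extChartAt I ξ.1) (F q) (mfderiv 𝓘(ℝ, V) I F q v) = _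
  rw [mfderiv_eq_fderiv] at h2
  exact (congrArg (fun L : V →L[ℝ] E => L v) h2).symm

theorem SmoothNear.contDiffAt {f : V → E} {q : V} (h : SmoothNear 𝓘(ℝ, V) 𝓘(ℝ, E) f q) :
    ContDiffAt ℝ ∞ f q :=
  h.contMDiffAt.contDiffAt

theorem SmoothNear.extChartAt_comp {x : N} {F : V → N} {q : V}
    (hF : SmoothNear 𝓘(ℝ, V) I F q) (h : F q ∈ (chartAt H x).source) :
    ContDiffAt ℝ ∞ (fun q => extChartAt I x (F q)) q :=
  (SmoothNear.comp (smoothNear_extChartAt (by rwa [extChartAt_source])) hF).contDiffAt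

/-- Second derivatives in the charts of `TTN`. -/
theorem extChartAt_dirVelocity_dirVelocity {ξ : TT I N} {u v : V} {F : V → N} {q : V}
    (hF : SmoothNear 𝓘(ℝ, V) I F q) (h : F q ∈ (chartAt H ξ.1.1).source)
    {f : V → E} (hf : f = fun q => extChartAt I ξ.1.1 (F q)) :
    extChartAt I.tangent.tangent ξ (dirVelocity u (dirVelocity v F) q) =
      ((f q, fderiv ℝ f q v), (fderiv ℝ f q u, fderiv ℝ (fderiv ℝ f) q u v)) := by
  have hf2 : ContDiffAt ℝ ∞ f q := hf ▸ hF.extChartAt_comp h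
  have hsrc : ∀ᶠ q' in 𝓝 q, F q' ∈ (chartAt H ξ.1.1).source :=
    hF.contMDiffAt.continuousAt.eventually ((chartAt H ξ.1.1).open_source.mem_nhds h)
  have h1 : (fun q' => extChartAt I.tangent ξ.1 (dirVelocity v F q')) =ᶠ[𝓝 q]
      fun q' => (f q', fderiv ℝ f q' v) := by
    filter_upwards [hF.eventually, hsrc] with q' h1 h2
    rw [extChartAt_dirVelocity h1.mdifferentiableAt h2, hf]
  rw [extChartAt_dirVelocity hF.dirVelocity.mdifferentiableAt
    (by rw [TangentBundle.mem_chart_source_iff]; exact h), h1.fderiv_eq, h1.eq_of_nhds]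
  have hd : DifferentiableAt ℝ f q := hf2.differentiableAt (by simp)
  have hd2 : DifferentiableAt ℝ (fderiv ℝ f) q :=
    (hf2.fderiv_right (m := ∞) (by simp)).differentiableAt (by simp)
  refine Prod.ext rfl ?_
  have := hd.hasFDerivAt.prodMk (hd2.hasFDerivAt.clm_apply (hasFDerivAt_const v q))
  rw [this.fderiv]
  simp

theorem mem_extChartAt_tangent_tangent_source {ξ η : TT I N} :
    η ∈ (extChartAt I.tangent.tangent ξ).source ↔ η.1.1 ∈ (chartAt H ξ.1.1).source := by
  rw [extChartAt_tangent_source, mem_ofPred_eq, TangentBundle.mem_chart_source_iff]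

/-- The canonical involution exchanges the order of differentiation. -/
theorem involution_dirVelocity {u v : V} {F : V → N} {q : V}
    (hF : SmoothNear 𝓘(ℝ, V) I F q) :
    involution (dirVelocity (I := I.tangent) u (dirVelocity (I := I) v F) q) =
      dirVelocity v (dirVelocity u F) q := by
  set ξ := dirVelocity (I := I.tangent) u (dirVelocity (I := I) v F) q with hξ
  have hx : F q ∈ (chartAt H ξ.1.1).source := mem_chart_source H (F q)
  have h1 := extChartAt_dirVelocity_dirVelocity (u := u) (v := v) hF hx rfl
  have h2 := extChartAt_dirVelocity_dirVelocity (u := v) (v := u) hF hx rfl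
  have hs : IsSymmSndFDerivAt ℝ (fun q => extChartAt I ξ.1.1 (F q)) q :=
    (hF.extChartAt_comp hx).isSymmSndFDerivAt (by simpa using two_le_infty)
  unfold involution
  dsimp only
  rw [← hξ] at h1
  rw [h1]
  -- By symmetry of the second derivative, the swapped coordinates are those of the derivative taken
  -- in the other order.
  rw [hs u v, ← h2, PartialEquiv.left_inv]
  rw [mem_extChartAt_tangent_tangent_source]
  exact hx

theorem involution_velocityFst_velocitySnd {F : ℝ × ℝ → N} {q : ℝ × ℝ}
    (hF : SmoothNear 𝓘(ℝ, ℝ × ℝ) I F q) :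
    involution (velocityFst (I := I.tangent) (velocitySnd (I := I) F) q) =
      velocitySnd (velocityFst F) q := by
  rw [velocityFst_velocitySnd hF, velocitySnd_velocityFst hF, involution_dirVelocity hF]

theorem involution_velocitySnd_velocityFst {F : ℝ × ℝ → N} {q : ℝ × ℝ}
    (hF : SmoothNear 𝓘(ℝ, ℝ × ℝ) I F q) :
    involution (velocitySnd (I := I.tangent) (velocityFst (I := I) F) q) =
      velocityFst (velocitySnd F) q := by
  rw [velocityFst_velocitySnd hF, velocitySnd_velocityFst hF, involution_dirVelocity hF]

/-- The differential of the preferred chart at its own centre is the identity, so the coordinates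
are the raw components. -/
theorem extChartAt_self_apply (ξ : TT I N) :
    extChartAt I.tangent.tangent ξ ξ =
      ((extChartAt I ξ.1.1 ξ.1.1, ξ.1.2), (ξ.2.1, ξ.2.2)) := by
  rw [extChartAt_tangent_apply (mem_chart_source _ _),
    extChartAt_tangent_apply (mem_chart_source _ _)]
  have h1 := congrArg (fun L : E →L[ℝ] E => L ξ.1.2) (mfderiv_extChartAt_self (I := I) (x := ξ.1.1))
  have h2 := congrArg (fun L : E × E →L[ℝ] E × E => L ξ.2)
    (mfderiv_extChartAt_self (I := I.tangent) (x := ξ.1))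
  exact Prod.ext (Prod.ext rfl h1) h2

/-- Every element of `TTN` is a second derivative of a two-parameter family. -/
theorem exists_dirVelocity_dirVelocity_eq [I.Boundaryless] (ξ : TT I N) :
    ∃ F : ℝ × ℝ → N, SmoothNear 𝓘(ℝ, ℝ × ℝ) I F 0 ∧
      ξ = dirVelocity ((1 : ℝ), (0 : ℝ)) (dirVelocity ((0 : ℝ), (1 : ℝ)) F) 0 := by
  set φ := extChartAt I ξ.1.1
  let y : E := ξ.1.2
  let X : E := ξ.2.1
  let Y : E := ξ.2.2
  -- This polynomial has value x, partial derivatives X and y, and mixed derivative Y at 0.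
  let p : ℝ × ℝ → E := fun q => φ ξ.1.1 + q.1 • X + q.2 • y + (q.1 * q.2) • Y
  have hp : ContDiff ℝ ∞ p := by fun_prop
  have hp0 : p 0 = φ ξ.1.1 := by simp [p]
  have ht : p 0 ∈ φ.target := hp0 ▸ mem_extChartAt_target ξ.1.1
  let F : ℝ × ℝ → N := fun q => φ.symm (p q)
  have hF : SmoothNear 𝓘(ℝ, ℝ × ℝ) I F 0 :=
    SmoothNear.comp (smoothNear_extChartAt_symm ht) (ContMDiff.smoothNear hp.contMDiff)
  have hF0 : F 0 = ξ.1.1 := by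
    simp only [F, hp0]; exact extChartAt_to_inv ξ.1.1
  refine ⟨F, hF, ?_⟩
  have hsrc : F 0 ∈ (chartAt H ξ.1.1).source := hF0 ▸ mem_chart_source H ξ.1.1
  refine (extChartAt I.tangent.tangent ξ).injOn (mem_extChartAt_source ξ)
    (mem_extChartAt_tangent_tangent_source.2 hsrc) ?_
  rw [extChartAt_dirVelocity_dirVelocity hF hsrc rfl, extChartAt_self_apply]
  have hfp : (fun q => φ (F q)) =ᶠ[𝓝 0] p := by
    have : ∀ᶠ q in 𝓝 (0 : ℝ × ℝ), p q ∈ φ.target :=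
      hp.continuous.continuousAt.eventually ((isOpen_extChartAt_target ξ.1.1).mem_nhds ht)
    filter_upwards [this] with q hq
    exact φ.right_inv hq
  have hdp : ∀ q, HasFDerivAt p ((ContinuousLinearMap.fst ℝ ℝ ℝ).smulRight X +
      (ContinuousLinearMap.snd ℝ ℝ ℝ).smulRight y +
      (q.1 • ContinuousLinearMap.snd ℝ ℝ ℝ + q.2 • ContinuousLinearMap.fst ℝ ℝ ℝ).smulRight Y) q := by
    intro q
    have h1 : HasFDerivAt (fun q : ℝ × ℝ => q.1) (ContinuousLinearMap.fst ℝ ℝ ℝ) q := hasFDerivAt_fst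
    have h2 : HasFDerivAt (fun q : ℝ × ℝ => q.2) (ContinuousLinearMap.snd ℝ ℝ ℝ) q := hasFDerivAt_snd
    exact (((h1.smul_const X).const_add (φ ξ.1.1)).add (h2.smul_const y)).add
      ((h1.mul h2).smul_const Y)
  have hdp2 : fderiv ℝ (fderiv ℝ p) 0 ((1 : ℝ), (0 : ℝ)) ((0 : ℝ), (1 : ℝ)) = Y := by
    have h1 : DifferentiableAt ℝ (fderiv ℝ p) 0 :=
      (hp.contDiffAt.fderiv_right (m := ∞) (by simp)).differentiableAt (by simp)
    have h2 := (h1.hasFDerivAt.clm_apply (hasFDerivAt_const ((0 : ℝ), (1 : ℝ)) (0 : ℝ × ℝ)))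
    have h3 : (fun q => fderiv ℝ p q ((0 : ℝ), (1 : ℝ))) = fun q : ℝ × ℝ => y + q.1 • Y := by
      ext q; simp [(hdp q).fderiv]
    have h4 : HasFDerivAt (fun q : ℝ × ℝ => y + q.1 • Y)
        ((ContinuousLinearMap.fst ℝ ℝ ℝ).smulRight Y) 0 :=
      (hasFDerivAt_fst.smul_const Y).const_add y
    rw [h3] at h2
    simpa using congrArg (fun L : ℝ × ℝ →L[ℝ] E => L ((1 : ℝ), (0 : ℝ))) (h2.unique h4)
  change _ = ((φ (F 0), fderiv ℝ (fun q => φ (F q)) 0 _),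
    (fderiv ℝ (fun q => φ (F q)) 0 _, fderiv ℝ (fderiv ℝ (fun q => φ (F q))) 0 _ _))
  rw [hfp.fderiv.fderiv_eq, hfp.fderiv_eq, hdp2, hF0, (hdp 0).fderiv]
  refine Prod.ext (Prod.ext rfl ?_) (Prod.ext ?_ rfl)
  · change y = _; simp
  · change X = _; simp

theorem tangentMap_proj_dirVelocity {u : V} {G : V → TangentBundle I N} {q : V}
    (hG : MDifferentiableAt 𝓘(ℝ, V) I.tangent G q) :
    tangentMap I.tangent I (TotalSpace.proj : TangentBundle I N → N) (dirVelocity u G q) =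
      dirVelocity u (fun q => (G q).1) q := by
  have hp : MDifferentiableAt I.tangent I (TotalSpace.proj : TangentBundle I N → N) (G q) :=
    (contMDiff_proj (n := 1) (TangentSpace I)).mdifferentiableAt (by simp)
  have := mfderiv_comp q hp hG
  unfold dirVelocity tangentMap
  exact (congrArg (fun L : V →L[ℝ] E => (⟨(G q).1, L u⟩ : TangentBundle I N)) this).symm

variable [I.Boundaryless]

/-- On mixed second derivatives of a family, the involution only reverses the order, and every
vector of `TTN` is of that form. -/
theorem involution_involution (ξ : TT I N) : involution (involution ξ) = ξ := by
  obtain ⟨F, hF, rfl⟩ := exists_dirVelocity_dirVelocity_eq ξ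
  rw [involution_dirVelocity hF, involution_dirVelocity hF]

theorem involution_proj (ξ : TT I N) :
    (involution ξ).1 = tangentMap I.tangent I (TotalSpace.proj : TangentBundle I N → N) ξ := by
  obtain ⟨F, hF, rfl⟩ := exists_dirVelocity_dirVelocity_eq ξ
  rw [involution_dirVelocity hF, tangentMap_proj_dirVelocity hF.dirVelocity.mdifferentiableAt]
  rfl

theorem tangentMap_proj_involution (ξ : TT I N) :
    tangentMap I.tangent I (TotalSpace.proj : TangentBundle I N → N) (involution ξ) = ξ.1 := by
  rw [← involution_proj, involution_involution]

/-- The definition of `involution` uses a chart that varies with the argument. Symmetry of second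
derivatives holds in every chart, so the coordinate formula is chart independent. -/
theorem extChartAt_involution {ξ η : TT I N} (h : η.1.1 ∈ (chartAt H ξ.1.1).source) :
    extChartAt I.tangent.tangent ξ (involution η) =
      (((extChartAt I.tangent.tangent ξ η).1.1, (extChartAt I.tangent.tangent ξ η).2.1),
        ((extChartAt I.tangent.tangent ξ η).1.2, (extChartAt I.tangent.tangent ξ η).2.2)) := by
  obtain ⟨F, hF, rfl⟩ := exists_dirVelocity_dirVelocity_eq η
  replace h : F 0 ∈ (chartAt H ξ.1.1).source := h
  rw [involution_dirVelocity hF, extChartAt_dirVelocity_dirVelocity hF h rfl,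
    extChartAt_dirVelocity_dirVelocity hF h rfl]
  have hs : IsSymmSndFDerivAt ℝ (fun q => extChartAt I ξ.1.1 (F q)) 0 :=
    (hF.extChartAt_comp h).isSymmSndFDerivAt (by simpa using two_le_infty)
  rw [hs]

/-- In a single fixed chart the map is the linear swap `σ`. -/
theorem smoothNear_involution (ξ : TT I N) :
    SmoothNear I.tangent.tangent I.tangent.tangent (involution (I := I) (N := N)) ξ := by
  set Φ := extChartAt I.tangent.tangent ξ
  let σ : (E × E) × (E × E) → (E × E) × (E × E) := fun p => ((p.1.1, p.2.1), (p.1.2, p.2.2))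
  have hbase (η : TT I N) : (involution η).1.1 = η.1.1 := by rw [involution_proj]; rfl
  have h1 : ∀ η ∈ Φ.source, Φ (involution η) = σ (Φ η) := fun η hη =>
    extChartAt_involution (mem_extChartAt_tangent_tangent_source.1 hη)
  have hsrc : ∀ η ∈ Φ.source, involution η ∈ Φ.source := fun η hη => by
    rw [mem_extChartAt_tangent_tangent_source] at hη ⊢
    rwa [hbase]
  have hξ : ξ ∈ Φ.source := mem_extChartAt_source ξ
  have hσ : ContDiff ℝ ∞ σ := by fun_prop
  have ht : σ (Φ ξ) ∈ Φ.target := h1 ξ hξ ▸ Φ.map_source (hsrc ξ hξ)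
  have h2 : SmoothNear I.tangent.tangent I.tangent.tangent (fun η => Φ.symm (σ (Φ η))) ξ :=
    SmoothNear.comp (g := fun p => Φ.symm (σ p)) (I' := 𝓘(ℝ, (E × E) × (E × E)))
      (SmoothNear.comp (smoothNear_extChartAt_symm ht) (ContMDiff.smoothNear hσ.contMDiff))
      (smoothNear_extChartAt hξ)
  refine h2.congr ?_
  filter_upwards [extChartAt_source_mem_nhds (I := I.tangent.tangent) ξ] with η hη
  rw [← h1 η hη, Φ.left_inv (hsrc η hη)]

end Involution

/-! ### The complete lift and its geodesics. -/

section CompleteLift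

variable {E : Type*} [NormedAddCommGroup E] [NormedSpace ℝ E]
  {H : Type*} [TopologicalSpace H] {I : ModelWithCorners ℝ E H}
  {N : Type*} [TopologicalSpace N] [ChartedSpace H N]

theorem velocity_comp_affine {c : ℝ → N} {a b t : ℝ}
    (hc : MDifferentiableAt 𝓘(ℝ, ℝ) I c (a * t + b)) :
    velocity (fun t => c (a * t + b)) t =
      (⟨c (a * t + b), a • (velocity (I := I) c (a * t + b)).2⟩ : TangentBundle I N) := by
  have h : HasDerivAt (fun t : ℝ => a * t + b) a t := by
    simpa using ((hasDerivAt_id t).const_mul a).add_const b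
  rw [velocity_comp_curve (F := c) (γ := fun t => a * t + b) hc h]
  unfold tangentMap velocity
  refine TotalSpace.ext rfl (heq_of_eq ?_)
  have := (mfderiv 𝓘(ℝ, ℝ) I c (a * t + b)).map_smul a (1 : ℝ)
  rw [← this]
  exact congrArg (mfderiv 𝓘(ℝ, ℝ) I c (a * t + b)) (mul_one a).symm

theorem velocity_comp_add {c : ℝ → N} {b t : ℝ}
    (hc : MDifferentiableAt 𝓘(ℝ, ℝ) I c (t + b)) :
    velocity (I := I) (fun t => c (t + b)) t = velocity c (t + b) :=
  velocity_comp_curve (F := c) (γ := fun t => t + b) hc ((hasDerivAt_id t).add_const b)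

variable [IsManifold I ∞ N]

theorem contMDiff_tangentProj :
    ContMDiff I.tangent I ∞ (TotalSpace.proj : TangentBundle I N → N) :=
  contMDiff_proj (TangentSpace I)

theorem mdifferentiable_tangentProj :
    MDifferentiable I.tangent I (TotalSpace.proj : TangentBundle I N → N) :=
  contMDiff_tangentProj.mdifferentiable (by simp)

variable [I.Boundaryless] {S : TangentBundle I N → TT I N}

theorem smoothNear_completeLift {ξ : TT I N}
    (hS : SmoothNear I.tangent I.tangent.tangent S (tangentMap I.tangent I TotalSpace.proj ξ)) :
    SmoothNear I.tangent.tangent I.tangent.tangent.tangent (completeLift S) ξ := by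
  rw [← involution_proj] at hS
  exact SmoothNear.comp (g := tangentMap I.tangent.tangent I.tangent.tangent involution)
    (smoothNear_involution _).tangentMap
    (SmoothNear.comp (g := involution) (smoothNear_involution _)
      (SmoothNear.comp (g := tangentMap I.tangent I.tangent.tangent S)
        hS.tangentMap (smoothNear_involution ξ)))

/-- The complete lift of a vector field is a vector field. -/
theorem completeLift_proj {ξ : TT I N}
    (hS : MDifferentiableAt I.tangent I.tangent.tangent S
      (tangentMap I.tangent I TotalSpace.proj ξ))
    (hbase : ∀ᶠ η in 𝓝 (tangentMap I.tangent I TotalSpace.proj ξ), (S η).1 = η) :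
    (completeLift S ξ).1 = ξ := by
  rw [← involution_proj] at hS hbase
  change involution (involution (tangentMap I.tangent I.tangent.tangent S (involution ξ))).1 = ξ
  rw [involution_proj, ← tangentMap_comp_at _ (mdifferentiable_tangentProj _) hS]
  have h : (TotalSpace.proj ∘ S) =ᶠ[𝓝 (involution ξ).1] id := hbase
  have h2 : tangentMap I.tangent I.tangent (TotalSpace.proj ∘ S) (involution ξ) = involution ξ := by
    have h3 : tangentMap I.tangent I.tangent (TotalSpace.proj ∘ S) (involution ξ) =
        tangentMap I.tangent I.tangent id (involution ξ) := by
      unfold tangentMap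
      rw [h.mfderiv_eq, h.eq_of_nhds]
    rw [h3, tangentMap_id, id]
  rw [h2, involution_involution]

/-- The complete lift is related to the original vector field by the projection. -/
theorem tangentMap_tangentMap_proj_completeLift (ξ : TT I N) :
    tangentMap I.tangent.tangent I.tangent
      (tangentMap I.tangent I (TotalSpace.proj : TangentBundle I N → N)) (completeLift S ξ) =
      S (tangentMap I.tangent I TotalSpace.proj ξ) := by
  unfold completeLift
  have hp : MDifferentiable I.tangent.tangent I.tangent
      (tangentMap I.tangent I (TotalSpace.proj : TangentBundle I N → N)) := fun η =>
    (SmoothNear.tangentMap (ContMDiff.smoothNear contMDiff_tangentProj)).mdifferentiableAt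
  rw [← tangentMap_comp_at _ (hp _) (smoothNear_involution _).mdifferentiableAt]
  -- Since Dπ ∘ κ is the bundle projection, composing with Dκ leaves only the base point of what κ
  -- was applied to.
  have h : tangentMap I.tangent I (TotalSpace.proj : TangentBundle I N → N) ∘ involution =
      TotalSpace.proj := funext tangentMap_proj_involution
  rw [h, ← involution_proj, involution_involution, ← involution_proj]
  rfl

/-- The variation field of a family of geodesics of `S` is a geodesic of the complete lift. -/
theorem velocitySnd_velocitySnd_velocityFst {F : ℝ × ℝ → N} {q : ℝ × ℝ}
    (hF : SmoothNear 𝓘(ℝ, ℝ × ℝ) I F q)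
    (hS : MDifferentiableAt I.tangent I.tangent.tangent S (velocitySnd F q))
    (h : ∀ᶠ q' in 𝓝 q, velocitySnd (velocitySnd F) q' = S (velocitySnd F q')) :
    velocitySnd (velocitySnd (velocityFst F)) q =
      completeLift S (velocitySnd (velocityFst F) q) := by
  unfold completeLift
  -- Following the factors of Sᶜ from the right: κ turns ∂ₜ∂ₛF into ∂ₛ∂ₜF, DS turns it into ∂ₛ∂ₜ∂ₜF
  -- by the geodesic equation, the next κ gives ∂ₜ∂ₛ∂ₜF, and Dκ gives ∂ₜ∂ₜ∂ₛF.
  rw [involution_velocitySnd_velocityFst hF, ← velocityFst_comp hS hF.velocitySnd,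
    velocityFst_congr (h.mono fun _ h => h.symm),
    involution_velocityFst_velocitySnd hF.velocitySnd,
    ← velocitySnd_comp (smoothNear_involution _).mdifferentiableAt hF.velocitySnd.velocityFst]
  exact velocitySnd_congr (hF.eventually.mono fun _ h =>
    (involution_velocityFst_velocitySnd h).symm)

/-- The tangent of a geodesic of `S` is a geodesic of the complete lift. -/
theorem velocity_velocity_velocity {c : ℝ → N} {t : ℝ}
    (hc : SmoothNear 𝓘(ℝ, ℝ) I c t)
    (hS : MDifferentiableAt I.tangent I.tangent.tangent S (velocity c t))
    (h : ∀ᶠ t' in 𝓝 t, velocity (velocity c) t' = S (velocity c t')) :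
    velocity (velocity (velocity c)) t = completeLift S (velocity (velocity c) t) := by
  -- The tangent of c is the variation field of its family of time translates.
  let F : ℝ × ℝ → N := fun q => c (q.1 + q.2)
  let q : ℝ × ℝ := (0, t)
  have hq : q.1 + q.2 = t := zero_add t
  have hcont : Continuous fun q : ℝ × ℝ => q.1 + q.2 := by fun_prop
  have hF : SmoothNear 𝓘(ℝ, ℝ × ℝ) I F q := by
    refine SmoothNear.comp (g := c) (f := fun q : ℝ × ℝ => q.1 + q.2) ?_
      (ContMDiff.smoothNear (contDiff_fst.add contDiff_snd).contMDiff)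
    rwa [hq]
  have hnear {P : ℝ → Prop} (hP : ∀ᶠ t' in 𝓝 t, P t') : ∀ᶠ q' in 𝓝 q, P (q'.1 + q'.2) := by
    refine hcont.continuousAt.eventually ?_
    change ∀ᶠ y in 𝓝 (q.1 + q.2), P y
    rwa [hq]
  have h1 {G : ℝ → N} {q : ℝ × ℝ} (hG : MDifferentiableAt 𝓘(ℝ, ℝ) I G (q.1 + q.2)) :
      velocityFst (I := I) (fun q => G (q.1 + q.2)) q = velocity G (q.1 + q.2) :=
    velocity_comp_add hG
  have h2 {G : ℝ → N} {q : ℝ × ℝ} (hG : MDifferentiableAt 𝓘(ℝ, ℝ) I G (q.1 + q.2)) :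
      velocitySnd (I := I) (fun q => G (q.1 + q.2)) q = velocity G (q.1 + q.2) := by
    have : (fun t => G (q.1 + t)) = fun t => G (t + q.1) := by simp [add_comm]
    unfold velocitySnd
    dsimp only
    rw [this, velocity_comp_add (by rwa [add_comm]), add_comm]
  have h3 {G : ℝ → TangentBundle I N} {q : ℝ × ℝ}
      (hG : MDifferentiableAt 𝓘(ℝ, ℝ) I.tangent G (q.1 + q.2)) :
      velocitySnd (I := I.tangent) (fun q => G (q.1 + q.2)) q = velocity G (q.1 + q.2) := by
    have : (fun t => G (q.1 + t)) = fun t => G (t + q.1) := by simp [add_comm]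
    unfold velocitySnd
    dsimp only
    rw [this, velocity_comp_add (by rwa [add_comm]), add_comm]
  have e1 : ∀ᶠ q' in 𝓝 q, velocitySnd (I := I) F q' = velocity c (q'.1 + q'.2) :=
    (hnear hc.eventually).mono fun q' h => h2 h.mdifferentiableAt
  have e2 : ∀ᶠ q' in 𝓝 q, velocitySnd (I := I.tangent) (velocitySnd (I := I) F) q' =
      velocity (velocity c) (q'.1 + q'.2) := by
    filter_upwards [eventually_eventually_nhds.2 e1, hnear hc.eventually] with q' h h'
    rw [velocitySnd_congr (I := I.tangent) h]
    exact h3 (G := velocity c) h'.velocity.mdifferentiableAt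
  have e3 : ∀ᶠ t' in 𝓝 t, velocityFst (I := I) F (0, t') = velocity c t' := by
    filter_upwards [hc.eventually] with t' h
    rw [h1 (by simpa using h.mdifferentiableAt)]
    simp
  have e4 : ∀ᶠ t' in 𝓝 t, velocitySnd (I := I.tangent) (velocityFst (I := I) F) (0, t') =
      velocity (velocity c) t' := (eventually_eventually_nhds.2 e3).mono fun _ h => velocity_congr h
  have e5 : velocitySnd (I := I.tangent.tangent) (velocitySnd (I := I.tangent)
      (velocityFst (I := I) F)) q = velocity (velocity (velocity c)) t := velocity_congr e4
  rw [← e5, ← e4.self_of_nhds]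
  refine velocitySnd_velocitySnd_velocityFst hF ?_ ?_
  · rw [e1.self_of_nhds, hq]; exact hS
  · filter_upwards [e1, e2, hnear h] with q' h1 h2 h3
    rw [h1, h2, h3]

/-- Geodesics of the complete lift project to geodesics of `S`. -/
theorem velocity_velocity_proj {J : ℝ → TangentBundle I N} {t : ℝ}
    (hJ : SmoothNear 𝓘(ℝ, ℝ) I.tangent J t)
    (h : velocity (velocity J) t = completeLift S (velocity J t)) :
    velocity (velocity fun t => (J t).1) t = S (velocity (fun t => (J t).1) t) := by
  have h1 : ∀ᶠ t' in 𝓝 t, velocity (I := I) (fun t => (J t).1) t' =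
      tangentMap I.tangent I TotalSpace.proj (velocity J t') :=
    hJ.eventually.mono fun t' h =>
      velocity_comp (f := TotalSpace.proj) (mdifferentiable_tangentProj _) h.mdifferentiableAt
  rw [velocity_congr h1, h1.self_of_nhds, ← tangentMap_tangentMap_proj_completeLift (S := S), ← h]
  exact velocity_comp (f := tangentMap I.tangent I TotalSpace.proj)
    (SmoothNear.tangentMap (ContMDiff.smoothNear contMDiff_tangentProj)).mdifferentiableAt
    hJ.velocity.mdifferentiableAt

end CompleteLift

/-! ### Uniqueness of geodesics. -/

section Uniqueness

variable {E : Type*} [NormedAddCommGroup E] [NormedSpace ℝ E]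
  {H : Type*} [TopologicalSpace H] {I : ModelWithCorners ℝ E H}
  {N : Type*} [TopologicalSpace N] [ChartedSpace H N] [IsManifold I ∞ N]

/-- Vectors over distinct points are separated in the base, vectors in one fibre by a
trivialization. Being an instance, it iterates to the higher tangent bundles where uniqueness is
needed. -/
instance tangentBundle_t2Space [T2Space N] : T2Space (TangentBundle I N) := by
  have hc : Continuous (TotalSpace.proj : TangentBundle I N → N) :=
    FiberBundle.continuous_proj E (TangentSpace I)
  refine ⟨fun ξ η h => ?_⟩
  by_cases hb : ξ.1 = η.1
  · let e := trivializationAt E (TangentSpace I : N → Type _) ξ.1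
    have hξ : ξ ∈ e.source := FiberBundle.mem_trivializationAt_proj_source
    have hη : η ∈ e.source := by
      rw [e.mem_source, ← hb]; exact FiberBundle.mem_baseSet_trivializationAt E (TangentSpace I) ξ.1
    have hne : e ξ ≠ e η := fun h' => h (e.injOn hξ hη h')
    obtain ⟨u, v, hu, hv, hξu, hηv, huv⟩ := t2_separation hne
    refine ⟨e.source ∩ e ⁻¹' u, e.source ∩ e ⁻¹' v,
      e.toOpenPartialHomeomorph.isOpen_inter_preimage hu,
      e.toOpenPartialHomeomorph.isOpen_inter_preimage hv, ⟨hξ, hξu⟩, ⟨hη, hηv⟩, ?_⟩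
    exact (huv.preimage e).mono inter_subset_right inter_subset_right
  · exact separated_by_continuous hc hb

variable {S : TangentBundle I N → TT I N} {U : Set (TangentBundle I N)}

/-- The second order equation for γ is a first order one for γ'. All tangent spaces are the same
model space definitionally, so `(S ξ).2` may serve as a vector at `ξ`. -/
theorem isMIntegralCurveAt_velocity {γ : ℝ → N} {t : ℝ}
    (hγ : SmoothNear 𝓘(ℝ, ℝ) I γ t)
    (h : ∀ᶠ t' in 𝓝 t, velocity (velocity γ) t' = S (velocity γ t')) :
    IsMIntegralCurveAt (I := I.tangent) (velocity γ) (fun ξ => (S ξ).2) t := by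
  filter_upwards [hγ.eventually, h] with t' h1 h2
  have h3 : (mfderiv 𝓘(ℝ, ℝ) I.tangent (velocity γ) t' (1 : ℝ) : E × E) =
      (S (velocity γ t')).2 := congrArg (fun η : TT I N => (η.2 : E × E)) h2
  have h4 : mfderiv 𝓘(ℝ, ℝ) I.tangent (velocity (I := I) γ) t' =
      (1 : ℝ →L[ℝ] ℝ).smulRight (mfderiv 𝓘(ℝ, ℝ) I.tangent (velocity (I := I) γ) t' (1 : ℝ)) := by
    refine ContinuousLinearMap.ext_ring ?_
    exact (one_smul ℝ (mfderiv 𝓘(ℝ, ℝ) I.tangent (velocity (I := I) γ) t' (1 : ℝ))).symm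
  have h5 := h1.velocity.mdifferentiableAt.hasMFDerivAt
  rw [h4] at h5
  have h6 (v : E × E) (hv : (mfderiv 𝓘(ℝ, ℝ) I.tangent (velocity γ) t' (1 : ℝ) : E × E) = v) :
    HasMFDerivAt 𝓘(ℝ, ℝ) I.tangent (velocity γ) t' ((1 : ℝ →L[ℝ] ℝ).smulRight v) := hv ▸ h5
  exact h6 _ h3

variable [I.Boundaryless] [T2Space N]

/-- Geodesics of a smooth second order field are determined by an initial velocity. -/
theorem eqOn_velocity_of_eq {s : Set ℝ} (hs : IsOpen s) (hs' : IsPreconnected s)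
    (hS : ∀ ξ ∈ U, SmoothNear I.tangent I.tangent.tangent S ξ)
    (hbase : ∀ ξ ∈ U, ∀ᶠ η in 𝓝 ξ, (S η).1 = η)
    {γ₁ γ₂ : ℝ → N} (hγ₁ : ContMDiffOn 𝓘(ℝ, ℝ) I ∞ γ₁ s) (hγ₂ : ContMDiffOn 𝓘(ℝ, ℝ) I ∞ γ₂ s)
    (hU : ∀ t ∈ s, velocity γ₁ t ∈ U)
    (h₁ : ∀ t ∈ s, velocity (velocity γ₁) t = S (velocity γ₁ t))
    (h₂ : ∀ t ∈ s, velocity (velocity γ₂) t = S (velocity γ₂ t))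
    {t₀ : ℝ} (ht₀ : t₀ ∈ s) (h : velocity (I := I) γ₁ t₀ = velocity γ₂ t₀) :
    ∀ t ∈ s, velocity (I := I) γ₁ t = velocity γ₂ t := by
  have hsm₁ (t) (ht : t ∈ s) := ContMDiffOn.smoothNear hγ₁ hs ht
  have hsm₂ (t) (ht : t ∈ s) := ContMDiffOn.smoothNear hγ₂ hs ht
  have key : ∀ t ∈ s, velocity (I := I) γ₁ t = velocity γ₂ t →
      velocity (I := I) γ₁ =ᶠ[𝓝 t] velocity γ₂ := by
    intro t ht heq
    refine isMIntegralCurveAt_eventuallyEq_of_contMDiffAt_boundaryless (I := I.tangent)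
      (v := fun ξ => (S ξ).2) ?_
      (isMIntegralCurveAt_velocity (hsm₁ t ht) (mem_of_superset (hs.mem_nhds ht) h₁))
      (isMIntegralCurveAt_velocity (hsm₂ t ht) (mem_of_superset (hs.mem_nhds ht) h₂)) heq
    refine ((hS _ (hU t ht)).contMDiffAt.of_le (by simp)).congr_of_eventuallyEq ?_
    filter_upwards [hbase _ (hU t ht)] with η hη
    exact TotalSpace.ext hη.symm HEq.rfl
  -- Connectedness argument: local agreement is an open condition, and at a limit point in `s` the
  -- velocities agree by continuity, so local uniqueness applies there again.
  have := hs'.subset_of_closure_inter_subset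
    (u := {t | velocity (I := I) γ₁ =ᶠ[𝓝 t] velocity γ₂}) isOpen_setOfPred_eventually_nhds
    ⟨t₀, ht₀, key t₀ ht₀ h⟩ ?_
  · exact fun t ht => (this ht).self_of_nhds
  · rintro t ⟨htc, ht⟩
    refine key t ht ?_
    refine tendsto_nhds_unique_of_frequently_eq
      (hsm₁ t ht).velocity.contMDiffAt.continuousAt
      (hsm₂ t ht).velocity.contMDiffAt.continuousAt ?_
    exact (mem_closure_iff_frequently.1 htc).mono fun t' h => h.self_of_nhds

end Uniqueness

/-! ### The Lie bracket in the preferred chart. -/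

section Bracket

variable {E : Type*} [NormedAddCommGroup E] [NormedSpace ℝ E]
  {H : Type*} [TopologicalSpace H] {I : ModelWithCorners ℝ E H}
  {N : Type*} [TopologicalSpace N] [ChartedSpace H N]

/-- A vector field read in the preferred chart at `x`. -/
def chartField (x : N) (X : (y : N) → TangentSpace I y) : E → E :=
  VectorField.mpullbackWithin 𝓘(ℝ, E) I (extChartAt I x).symm X (range I)

variable [IsManifold I ∞ N]

theorem chartField_apply {x : N} (X : (y : N) → TangentSpace I y) {p : E}
    (hp : p ∈ (extChartAt I x).target) :
    chartField x X p =
      mfderiv I 𝓘(ℝ, E) (extChartAt I x) ((extChartAt I x).symm p) (X ((extChartAt I x).symm p)) := by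
  unfold chartField
  rw [VectorField.mpullbackWithin_apply]
  have h1 := mfderivWithin_extChartAt_symm_comp_mfderiv_extChartAt (I := I) hp
  have h2 := mfderiv_extChartAt_comp_mfderivWithin_extChartAt_symm (I := I) hp
  rw [ContinuousLinearMap.inverse_eq h1 h2]
  rfl

theorem chartField_self (x : N) (X : (y : N) → TangentSpace I y) :
    chartField x X (extChartAt I x x) = X x := by
  rw [chartField_apply X (mem_extChartAt_target x)]
  have h (y : N) (hy : y = x) : (mfderiv I 𝓘(ℝ, E) (extChartAt I x) y (X y) : E) = X x := by
    subst hy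
    exact congrArg (fun L : E →L[ℝ] E => L (X y)) (mfderiv_extChartAt_self (I := I) (x := y))
  exact h _ (extChartAt_to_inv x)

/-- The chart at `x` has identity differential at `x`, so pulling the coordinate bracket back
changes nothing. -/
theorem mlieBracket_eq_chart [I.Boundaryless] (x : N) (X Y : (y : N) → TangentSpace I y) :
    VectorField.mlieBracket I X Y x =
      fderiv ℝ (chartField x Y) (extChartAt I x x) (X x) -
        fderiv ℝ (chartField x X) (extChartAt I x x) (Y x) := by
  rw [← VectorField.mlieBracketWithin_univ, VectorField.mlieBracketWithin_apply,
    mfderiv_extChartAt_self]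
  have h1 : ((extChartAt I x).symm ⁻¹' univ ∩ range I : Set E) = univ := by
    rw [I.range_eq_univ, preimage_univ, univ_inter]
  rw [h1]
  have h2 : (ContinuousLinearMap.id ℝ (TangentSpace I x)).inverse = ContinuousLinearMap.id ℝ _ :=
    ContinuousLinearMap.inverse_id
  have h3 : ∀ w : E, (ContinuousLinearMap.id ℝ (TangentSpace I x)).inverse w = w := fun w => by
    exact congrArg (fun L : E →L[ℝ] E => L w) h2
  refine (h3 _).trans ?_
  refine (congrFun (VectorField.lieBracketWithin_univ (𝕜 := ℝ) (V := chartField x X)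
    (W := chartField x Y)) _).trans ?_
  change fderiv ℝ (chartField x Y) _ (chartField x X _) -
    fderiv ℝ (chartField x X) _ (chartField x Y _) = _
  rw [chartField_self, chartField_self]

theorem chartField_contDiffAt [I.Boundaryless] {x : N} {X : (y : N) → TangentSpace I y} {p : E}
    (hp : p ∈ (extChartAt I x).target)
    (hX : SmoothNear I I.tangent (fun y => (⟨y, X y⟩ : TangentBundle I N))
      ((extChartAt I x).symm p)) :
    ContDiffAt ℝ ∞ (chartField x X) p := by
  -- Only the base point matters: it selects the bundle chart whose fibre component is `chartField`.
  let ξ : TangentBundle I N := ⟨x, 0⟩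
  have hsrc : (extChartAt I x).symm p ∈ (chartAt H x).source := by
    rw [← extChartAt_source I]; exact (extChartAt I x).map_target hp
  have h1 : SmoothNear 𝓘(ℝ, E) 𝓘(ℝ, E × E) (fun p => extChartAt I.tangent ξ
      (⟨(extChartAt I x).symm p, X ((extChartAt I x).symm p)⟩ : TangentBundle I N)) p := by
    refine SmoothNear.comp (I' := I.tangent) (smoothNear_extChartAt ?_)
      (SmoothNear.comp (f := (extChartAt I x).symm) hX (smoothNear_extChartAt_symm hp))
    rw [extChartAt_tangent_source]
    exact hsrc
  refine (contDiff_snd.contDiffAt.comp p h1.contDiffAt).congr_of_eventuallyEq ?_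
  filter_upwards [(isOpen_extChartAt_target (I := I) x).mem_nhds hp] with q hq
  have hsrc : (extChartAt I x).symm q ∈ (chartAt H x).source := by
    rw [← extChartAt_source I]; exact (extChartAt I x).map_target hq
  rw [chartField_apply X hq, Function.comp_apply, extChartAt_tangent_apply (ξ := ξ) hsrc]

end Bracket

/-! ### Fibrewise scaling and the Liouville field. -/

section Scaling

variable {E : Type*} [NormedAddCommGroup E] [NormedSpace ℝ E]
  {H : Type*} [TopologicalSpace H] {I : ModelWithCorners ℝ E H}
  {N : Type*} [TopologicalSpace N] [ChartedSpace H N] [IsManifold I ∞ N]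
  {E' : Type*} [NormedAddCommGroup E'] [NormedSpace ℝ E']
  {H' : Type*} [TopologicalSpace H'] {I' : ModelWithCorners ℝ E' H'}
  {N' : Type*} [TopologicalSpace N'] [ChartedSpace H' N']

/-- Multiplication by a scalar in the fibres of the tangent bundle. -/
def fiberSmul (r : ℝ) (ξ : TangentBundle I N) : TangentBundle I N :=
  ⟨ξ.1, r • ξ.2⟩

theorem extChartAt_fiberSmul {ξ η : TangentBundle I N} (h : η.1 ∈ (chartAt H ξ.1).source) (r : ℝ) :
    extChartAt I.tangent ξ (fiberSmul r η) =
      ((extChartAt I.tangent ξ η).1, r • (extChartAt I.tangent ξ η).2) := by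
  rw [extChartAt_tangent_apply h, extChartAt_tangent_apply (η := fiberSmul r η) h]
  exact Prod.ext rfl ((mfderiv I 𝓘(ℝ, E) (extChartAt I ξ.1) η.1).map_smul r η.2)

theorem SmoothNear.fiberSmul [I.Boundaryless] {g : N' → ℝ} {G : N' → TangentBundle I N} {x : N'}
    (hg : SmoothNear I' 𝓘(ℝ, ℝ) g x) (hG : SmoothNear I' I.tangent G x) :
    SmoothNear I' I.tangent (fun y => SprayGeometry.fiberSmul (g y) (G y)) x := by
  set Φ := extChartAt I.tangent (G x)
  have hsrc : ∀ᶠ y in 𝓝 x, G y ∈ Φ.source :=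
    hG.contMDiffAt.continuousAt.eventually (extChartAt_source_mem_nhds (G x))
  have hmem (y) (hy : G y ∈ Φ.source) (r : ℝ) : SprayGeometry.fiberSmul r (G y) ∈ Φ.source := by
    rw [extChartAt_tangent_source] at hy ⊢; exact hy
  have hΦ (y) (hy : G y ∈ Φ.source) (r : ℝ) :
      Φ (SprayGeometry.fiberSmul r (G y)) = ((Φ (G y)).1, r • (Φ (G y)).2) := by
    rw [extChartAt_tangent_source] at hy
    exact extChartAt_fiberSmul hy r
  have h1 : SmoothNear I' 𝓘(ℝ, E × E) (fun y => Φ (G y)) x :=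
    SmoothNear.comp (I' := I.tangent) (smoothNear_extChartAt (mem_extChartAt_source _)) hG
  have h2 : SmoothNear I' 𝓘(ℝ, E × E) (fun y => ((Φ (G y)).1, g y • (Φ (G y)).2)) x := by
    filter_upwards [h1, hg] with y hy hgy
    exact (contDiff_fst.contMDiff.contMDiffAt.comp y hy).prodMk_space
      (hgy.smul (contDiff_snd.contMDiff.contMDiffAt.comp y hy))
  have hx : G x ∈ Φ.source := mem_extChartAt_source _
  have h3 : SmoothNear I' I.tangent (fun y => Φ.symm ((Φ (G y)).1, g y • (Φ (G y)).2)) x := by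
    refine SmoothNear.comp (g := Φ.symm) (I' := 𝓘(ℝ, E × E)) (smoothNear_extChartAt_symm ?_) h2
    rw [← hΦ x hx]
    exact Φ.map_source (hmem x hx _)
  refine h3.congr (hsrc.mono fun y hy => ?_)
  dsimp only
  rw [← hΦ y hy, Φ.left_inv (hmem y hy _)]

theorem extChartAt_tangent_fiber (ξ : TangentBundle I N) (v : E) :
    extChartAt I.tangent ξ (⟨ξ.1, v⟩ : TangentBundle I N) = (extChartAt I ξ.1 ξ.1, v) := by
  refine (extChartAt_tangent_apply (η := ⟨ξ.1, v⟩) (mem_chart_source H ξ.1)).trans ?_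
  exact Prod.ext rfl (congrArg (fun L : E →L[ℝ] E => L v)
    (mfderiv_extChartAt_self (I := I) (x := ξ.1)))

variable [I.Boundaryless]

theorem smoothNear_fiberSmul (r : ℝ) (ξ : TangentBundle I N) :
    SmoothNear I.tangent I.tangent (fiberSmul r) ξ :=
  SmoothNear.fiberSmul (G := fun ξ => ξ) (ContMDiff.smoothNear contMDiff_const)
    (ContMDiff.smoothNear contMDiff_id)

/-- In the preferred coordinates the differential of the fibrewise multiplication by `r` multiplies
the vertical component by `r`. -/
theorem mfderiv_fiberSmul (r : ℝ) (ξ : TangentBundle I N) (w : E × E) :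
    mfderiv I.tangent I.tangent (fiberSmul r) ξ w = ((w.1, r • w.2) : E × E) := by
  set Φ := extChartAt I.tangent ξ
  have hΦ' : extChartAt I.tangent (fiberSmul r ξ) = Φ := extChartAt_tangent_congr rfl
  let m : E × E →L[ℝ] E × E :=
    (ContinuousLinearMap.fst ℝ E E).prod (r • ContinuousLinearMap.snd ℝ E E)
  have h1 : (fun η => Φ (fiberSmul r η)) =ᶠ[𝓝 ξ] fun η => m (Φ η) := by
    filter_upwards [extChartAt_source_mem_nhds (I := I.tangent) ξ] with η hη
    rw [extChartAt_tangent_source] at hη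
    exact extChartAt_fiberSmul hη r
  have hd1 : MDifferentiableAt I.tangent 𝓘(ℝ, E × E) Φ (fiberSmul r ξ) :=
    hΦ' ▸ (smoothNear_extChartAt (mem_extChartAt_source _)).mdifferentiableAt
  have hd2 : MDifferentiableAt I.tangent 𝓘(ℝ, E × E) Φ ξ :=
    (smoothNear_extChartAt (mem_extChartAt_source _)).mdifferentiableAt
  have h2 := mfderiv_comp ξ hd1 (smoothNear_fiberSmul r ξ).mdifferentiableAt
  have h3 := mfderiv_comp ξ (m.differentiableAt.mdifferentiableAt (x := Φ ξ)) hd2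
  have h4 : mfderiv I.tangent 𝓘(ℝ, E × E) (Φ ∘ fiberSmul r) ξ =
    mfderiv I.tangent 𝓘(ℝ, E × E) (m ∘ Φ) ξ := h1.mfderiv_eq
  rw [h2, h3, mfderiv_eq_fderiv, m.fderiv] at h4
  have h5 := congrArg (fun L : E × E →L[ℝ] E × E => L w) h4
  have h6 := mfderiv_extChartAt_self (I := I.tangent) (x := ξ)
  have h7 := mfderiv_extChartAt_self (I := I.tangent) (x := fiberSmul r ξ)
  rw [hΦ'] at h7
  have h8 : ∀ w : E × E, (mfderiv I.tangent 𝓘(ℝ, E × E) Φ ξ w : E × E) = w := fun w =>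
    congrArg (fun L : E × E →L[ℝ] E × E => L w) h6
  have h9 : ∀ w : E × E, (mfderiv I.tangent 𝓘(ℝ, E × E) Φ (fiberSmul r ξ) w : E × E) = w := fun w =>
    congrArg (fun L : E × E →L[ℝ] E × E => L w) h7
  have h10 : (mfderiv I.tangent I.tangent (fiberSmul r) ξ w : E × E) = m w := by
    refine (h9 _).symm.trans (h5.trans ?_)
    exact congrArg m (h8 w)
  exact h10

/-- In any bundle chart the defining curve is s ↦ (x, (1 + s)y), with derivative (0, y). The formula
is needed near ξ, not only at it, because the bracket differentiates the field. -/
theorem mfderiv_extChartAt_liouville {ξ η : TangentBundle I N} (h : η.1 ∈ (chartAt H ξ.1).source) :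
    mfderiv I.tangent 𝓘(ℝ, E × E) (extChartAt I.tangent ξ) η (liouville η) =
      ((0, (extChartAt I.tangent ξ η).2) : E × E) := by
  set Φ := extChartAt I.tangent ξ
  let γ : ℝ → TangentBundle I N := fun s => fiberSmul (1 + s) η
  have hγ0 : γ 0 = η := by
    refine TotalSpace.ext rfl (heq_of_eq ?_)
    change (1 + (0 : ℝ)) • η.2 = η.2
    rw [add_zero, one_smul]
  have hγ : MDifferentiableAt 𝓘(ℝ, ℝ) I.tangent γ 0 :=
    (SmoothNear.fiberSmul (g := fun s => 1 + s) (G := fun _ => η) (x := (0 : ℝ))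
      (ContMDiff.smoothNear (contDiff_const.add contDiff_id).contMDiff)
      (ContMDiff.smoothNear contMDiff_const)).mdifferentiableAt
  have hη : η ∈ (extChartAt I.tangent ξ).source := by rw [extChartAt_tangent_source]; exact h
  have hd : MDifferentiableAt I.tangent 𝓘(ℝ, E × E) Φ (γ 0) := by
    rw [hγ0]; exact (smoothNear_extChartAt hη).mdifferentiableAt
  have h1 := mfderiv_comp 0 hd hγ
  have h2 : Φ ∘ γ = fun s => ((Φ η).1, (1 + s) • (Φ η).2) :=
    funext fun s => extChartAt_fiberSmul h (1 + s)
  have h3 : HasDerivAt (fun s : ℝ => ((Φ η).1, (1 + s) • (Φ η).2)) ((0 : E), (Φ η).2) 0 := by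
    have := ((hasDerivAt_id (0 : ℝ)).const_add 1).smul_const (Φ η).2
    rw [one_smul] at this
    exact (hasDerivAt_const _ _).prodMk this
  rw [h2, mfderiv_eq_fderiv] at h1
  have h4 := congrArg (fun L : ℝ →L[ℝ] E × E => L 1) h1
  have h5 : fderiv ℝ (fun s : ℝ => ((Φ η).1, (1 + s) • (Φ η).2)) 0 1 = (0, (Φ η).2) := by
    rw [fderiv_apply_one_eq_deriv, h3.deriv]
  refine Eq.trans ?_ (h4.symm.trans h5)
  have h6 : ∀ y (w : E × E), y = η →
    (mfderiv I.tangent 𝓘(ℝ, E × E) Φ η w : E × E) = mfderiv I.tangent 𝓘(ℝ, E × E) Φ y w := by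
    rintro y w rfl; rfl
  exact h6 _ _ hγ0

/-- In the preferred coordinates the Liouville field is vertical. -/
theorem liouville_eq (ξ : TangentBundle I N) : liouville ξ = ((0, ξ.2) : E × E) := by
  have h1 := mfderiv_extChartAt_liouville (mem_chart_source H ξ.1)
  have h2 := congrArg (fun L : E × E →L[ℝ] E × E => L (liouville ξ))
    (mfderiv_extChartAt_self (I := I.tangent) (x := ξ))
  refine h2.symm.trans (h1.trans ?_)
  have := extChartAt_tangent_fiber ξ ξ.2
  exact congrArg (fun p : E × E => ((0 : E), p.2)) this

end Scaling

/-! ### From [E₁, S] = S to positive homogeneity. -/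

section Homogeneity

/-- Euler's theorem: r⁻ⁿ h(r) has zero derivative on the half-line. -/
theorem eq_of_hasDerivAt_radial {E : Type*} [NormedAddCommGroup E] [NormedSpace ℝ E]
    {h : ℝ → E} {n : ℕ} (hh : ∀ r : ℝ, 0 < r → HasDerivAt h ((r⁻¹ * n) • h r) r) {r : ℝ} (hr : 0 < r) :
    h r = r ^ n • h 1 := by
  let k : ℝ → E := fun r => (r ^ n)⁻¹ • h r
  have hk (t : ℝ) (ht : 0 < t) : HasDerivAt k 0 t := by
    have h3 := ((hasDerivAt_pow n t).inv (pow_ne_zero n ht.ne')).smul (hh t ht)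
    refine h3.congr_deriv ?_
    rw [smul_smul, ← add_smul]
    refine smul_eq_zero_of_left ?_ _
    rw [Pi.inv_apply]
    -- The derivative of tⁿ involves the truncated exponent n − 1, so n = 0 is separate.
    cases n with
    | zero => simp
    | succ n =>
      simp only [Nat.add_sub_cancel]
      field_simp
      ring
  have hconst : k r = k 1 :=
    isOpen_Ioi.is_const_of_fderiv_eq_zero (𝕜 := ℝ) (convex_Ioi (0 : ℝ)).isPreconnected
      (fun t ht => (hk t ht).differentiableAt.differentiableWithinAt)
      (fun t ht => by rw [(hk t ht).hasFDerivAt.fderiv]; simp) hr (mem_Ioi.2 one_pos)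
  simp only [k, one_pow, inv_one, one_smul] at hconst
  rwa [inv_smul_eq_iff₀ (pow_ne_zero n hr.ne')] at hconst

theorem eq_of_fderiv_radial {E : Type*} [NormedAddCommGroup E] [NormedSpace ℝ E]
    {g : E × E → E × E} {a v : E} (hd : ∀ r : ℝ, 0 < r → DifferentiableAt ℝ g (a, r • v))
    (hg : ∀ r : ℝ, 0 < r → fderiv ℝ g (a, r • v) (0, r • v) =
      ((g (a, r • v)).1, (2 : ℝ) • (g (a, r • v)).2)) {r : ℝ} (hr : 0 < r) :
    g (a, r • v) = (r • (g (a, v)).1, r ^ 2 • (g (a, v)).2) := by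
  have h (r : ℝ) (hr : 0 < r) : HasDerivAt (fun r : ℝ => g (a, r • v))
      (r⁻¹ • ((g (a, r • v)).1, (2 : ℝ) • (g (a, r • v)).2)) r := by
    have hcurve : HasDerivAt (fun r : ℝ => (a, r • v)) ((0 : E), v) r := by
      have := (hasDerivAt_id r).smul_const v
      rw [one_smul] at this
      exact (hasDerivAt_const _ _).prodMk this
    have h1 := (hd r hr).hasFDerivAt.comp_hasDerivAt r hcurve
    have h3 : ((0 : E), r • v) = r • ((0 : E), v) := Prod.ext (smul_zero r).symm rfl
    rw [← hg r hr, h3, map_smul, inv_smul_smul₀ hr.ne']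
    exact h1
  have h1 := eq_of_hasDerivAt_radial (n := 1) (h := fun r : ℝ => (g (a, r • v)).1)
    (fun r hr => by simpa using (h r hr).hasFDerivAt.fst.hasDerivAt) hr
  have h2 := eq_of_hasDerivAt_radial (n := 2) (h := fun r : ℝ => (g (a, r • v)).2)
    (fun r hr => by simpa [smul_smul] using (h r hr).hasFDerivAt.snd.hasDerivAt) hr
  simp only [one_smul, pow_one] at h1 h2
  exact Prod.ext h1 h2

variable {E : Type*} [NormedAddCommGroup E] [NormedSpace ℝ E]
  {H : Type*} [TopologicalSpace H] {I : ModelWithCorners ℝ E H}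
  {N : Type*} [TopologicalSpace N] [ChartedSpace H N]

theorem mem_slashed_id {ξ : TangentBundle I N} : ξ ∈ slashed I I (id : N → N) ↔ ξ.2 ≠ 0 := by
  unfold slashed
  rw [mem_ofPred_eq, tangentMap_id]
  rfl

variable [IsManifold I ∞ N]

/-- The complement is the coincidence set of the identity and ξ ↦ 0 over the base point of ξ, closed
by the Hausdorff property. -/
theorem isOpen_slashed_id [T2Space N] : IsOpen (slashed I I (id : N → N)) := by
  have h : slashed I I (id : N → N) =
      {ξ : TangentBundle I N | ξ = zeroSection E (TangentSpace I) ξ.1}ᶜ := by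
    ext ξ
    rw [mem_slashed_id, mem_compl_iff, mem_ofPred_eq, not_iff_not]
    constructor
    · exact fun h => TotalSpace.ext rfl (heq_of_eq h)
    · intro h
      rw [h]
      rfl
  rw [h]
  have hz : Continuous (zeroSection E (TangentSpace I : N → Type _)) :=
    (contMDiff_zeroSection (IB := I) (n := 0) ℝ (TangentSpace I)).continuous
  exact (isClosed_eq continuous_id
    (hz.comp (FiberBundle.continuous_proj E (TangentSpace I)))).isOpen_compl

theorem Spray.smoothNear [T2Space N] (S : Spray I N) {ξ : TangentBundle I N} (hξ : ξ ∈ slashed I I (id : N → N)) :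
    SmoothNear I.tangent I.tangent.tangent S.toMap ξ :=
  ContMDiffOn.smoothNear S.smooth isOpen_slashed_id hξ

variable [I.Boundaryless]

/-- With E₁ = (0, y) in the chart, the bracket is DS(0, y) − (0, S₂). Equating it with (S₁, S₂)
gives Euler's relations of degrees 1 and 2. -/
theorem Spray.fderiv_chartField (S : Spray I N) {ξ : TangentBundle I N} (hξ : ξ.2 ≠ 0) :
    fderiv ℝ (chartField ξ S.toFun) (extChartAt I.tangent ξ ξ) ((0, ξ.2) : E × E) =
      (((S.toFun ξ : E × E)).1, (2 : ℝ) • ((S.toFun ξ : E × E)).2) := by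
  have h1 := S.homogeneous ξ (mem_slashed_id.2 hξ)
  rw [mlieBracket_eq_chart] at h1
  have h2 : chartField (I := I.tangent) ξ liouville =ᶠ[𝓝 (extChartAt I.tangent ξ ξ)]
      fun p : E × E => (0, p.2) := by
    filter_upwards [(isOpen_extChartAt_target (I := I.tangent) ξ).mem_nhds
      (mem_extChartAt_target ξ)] with p hp
    have hp' := (extChartAt I.tangent ξ).map_target hp
    rw [extChartAt_tangent_source] at hp'
    rw [chartField_apply _ hp, mfderiv_extChartAt_liouville hp',
      (extChartAt I.tangent ξ).right_inv hp]
  have h3 : fderiv ℝ (fun p : E × E => ((0 : E), p.2)) (extChartAt I.tangent ξ ξ) =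
      (0 : E × E →L[ℝ] E).prod (ContinuousLinearMap.snd ℝ E E) :=
    ((hasFDerivAt_const _ _).prodMk hasFDerivAt_snd).fderiv
  rw [h2.fderiv_eq, h3, liouville_eq] at h1
  have h4 : fderiv ℝ (chartField ξ S.toFun) (extChartAt I.tangent ξ ξ) ((0, ξ.2) : E × E) -
      ((0 : E), (S.toFun ξ : E × E).2) = (S.toFun ξ : E × E) := h1
  refine (sub_eq_iff_eq_add.1 h4).trans (Prod.ext (add_zero _) ?_)
  exact (two_smul ℝ (S.toFun ξ : E × E).2).symm

variable [T2Space N]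

/-- All vectors rξ have the same preferred chart, so a single coordinate field `g` describes S along
the ray and the radial equation can be integrated. -/
theorem Spray.toFun_smul (S : Spray I N) {ξ : TangentBundle I N} (hξ : ξ.2 ≠ 0) {r : ℝ}
    (hr : 0 < r) :
    (S.toFun (fiberSmul r ξ) : E × E) =
      (r • (S.toFun ξ : E × E).1, r ^ 2 • (S.toFun ξ : E × E).2) := by
  set Φ := extChartAt I.tangent ξ with hΦdef
  obtain ⟨v, hv⟩ : ∃ v : E, v = ξ.2 := ⟨_, rfl⟩
  let a : E := extChartAt I ξ.1 ξ.1
  let g : E × E → E × E := chartField (I := I.tangent) ξ S.toFun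
  have hΦ (r : ℝ) : extChartAt I.tangent (fiberSmul r ξ) = Φ := extChartAt_tangent_congr rfl
  have hfield (r : ℝ) : chartField (I := I.tangent) (fiberSmul r ξ) S.toFun = g := by
    unfold chartField g chartField
    rw [hΦ]
  have hpt (r : ℝ) : Φ (fiberSmul r ξ) = (a, r • v) := by
    rw [hv]; exact extChartAt_tangent_fiber ξ _
  have hh (r : ℝ) : (S.toFun (fiberSmul r ξ) : E × E) = g (a, r • v) := by
    have h1 := chartField_self (I := I.tangent) (fiberSmul r ξ) S.toFun
    rw [hfield, hΦ, hpt] at h1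
    exact h1.symm
  have hne (r : ℝ) (hr : 0 < r) : (fiberSmul r ξ).2 ≠ 0 := smul_ne_zero hr.ne' hξ
  have hone : fiberSmul 1 ξ = ξ := TotalSpace.ext rfl (heq_of_eq (one_smul ℝ ξ.2))
  have h1 := hh 1
  rw [hone, one_smul] at h1
  have hd (r : ℝ) (hr : 0 < r) : DifferentiableAt ℝ g (a, r • v) := by
    have hmem : (a, r • v) ∈ Φ.target := by
      rw [← hpt, ← hΦ r]; exact mem_extChartAt_target _
    have hpt' : Φ.symm (a, r • v) = fiberSmul r ξ := by
      rw [← hpt, ← hΦ r]; exact extChartAt_to_inv _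
    refine (chartField_contDiffAt hmem ?_).differentiableAt (n := ∞) (by simp)
    rw [← hΦdef, hpt']
    exact S.smoothNear (mem_slashed_id.2 (hne r hr))
  have hg (r : ℝ) (hr : 0 < r) : fderiv ℝ g (a, r • v) (0, r • v) =
      ((g (a, r • v)).1, (2 : ℝ) • (g (a, r • v)).2) := by
    have h2 := S.fderiv_chartField (hne r hr)
    rw [hfield, hΦ, hpt, hh] at h2
    rw [hv] at h2 ⊢
    exact h2
  have h2 := eq_of_fderiv_radial hd hg hr
  rw [hh, h2, ← h1]

/-- A spray is positively homogeneous. -/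
theorem Spray.toMap_fiberSmul (S : Spray I N) {ξ : TangentBundle I N} (hξ : ξ.2 ≠ 0) {r : ℝ}
    (hr : 0 < r) :
    S.toMap (fiberSmul r ξ) =
      tangentMap I.tangent I.tangent (fiberSmul r) ⟨ξ, r • S.toFun ξ⟩ := by
  refine TotalSpace.ext rfl (heq_of_eq ?_)
  refine (S.toFun_smul hξ hr).trans ((mfderiv_fiberSmul r ξ (r • S.toFun ξ)).trans ?_).symm
  refine Prod.ext rfl ?_
  change r • r • (S.toFun ξ : E × E).2 = _
  rw [smul_smul, pow_two]

end Homogeneity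

/-! ### The affine variation and the second order curve. -/

section SecondOrder

variable {E : Type*} [NormedAddCommGroup E] [NormedSpace ℝ E]
  {H : Type*} [TopologicalSpace H] {I : ModelWithCorners ℝ E H}
  {N : Type*} [TopologicalSpace N] [ChartedSpace H N]

/-- The variation of a curve by affine reparametrisations `t ↦ (1 + β s) t + α s`. -/
def affineVariation (c : ℝ → N) (α β : ℝ) (q : ℝ × ℝ) : N :=
  c ((1 + β * q.1) * q.2 + α * q.1)

variable {c : ℝ → N} {α β t : ℝ}

theorem eventually_affine {P : ℝ → Prop} (h : ∀ᶠ u in 𝓝 t, P u) :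
    ∀ᶠ q : ℝ × ℝ in 𝓝 (0, t), P ((1 + β * q.1) * q.2 + α * q.1) := by
  have hc : Continuous fun q : ℝ × ℝ => (1 + β * q.1) * q.2 + α * q.1 := by fun_prop
  refine (hc.continuousAt (x := ((0 : ℝ), t))).eventually ?_
  simpa using h

theorem smoothNear_affineVariation (hc : SmoothNear 𝓘(ℝ, ℝ) I c t) :
    SmoothNear 𝓘(ℝ, ℝ × ℝ) I (affineVariation c α β) (0, t) := by
  refine SmoothNear.comp (I' := 𝓘(ℝ, ℝ)) (g := c) (f := fun q : ℝ × ℝ => (1 + β * q.1) * q.2 + α * q.1) ?_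
    (ContMDiff.smoothNear ?_)
  · simpa using hc
  · exact ContDiff.contMDiff (by fun_prop)

/-- For fixed t the variation is s ↦ c((α + βt)s + t), again an affine reparametrisation. -/
theorem velocityFst_affineVariation (hc : MDifferentiableAt 𝓘(ℝ, ℝ) I c t) :
    velocityFst (affineVariation c α β) (0, t) = parallelField (I := I) c α β t := by
  have h : (fun s => affineVariation c α β (s, t)) = fun s => c ((α + β * t) * s + t) := by
    funext s
    unfold affineVariation
    congr 1
    ring
  have h0 : (α + β * t) * 0 + t = t := by ring
  unfold velocityFst
  dsimp only
  rw [h, velocity_comp_affine (by rwa [h0]), h0]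
  exact TotalSpace.ext rfl (heq_of_eq (add_smul α (β * t) (velocity (I := I) c t).2))

theorem velocitySnd_affineVariation {q : ℝ × ℝ}
    (hc : MDifferentiableAt 𝓘(ℝ, ℝ) I c ((1 + β * q.1) * q.2 + α * q.1)) :
    velocitySnd (affineVariation c α β) q =
      fiberSmul (1 + β * q.1) (velocity (I := I) c ((1 + β * q.1) * q.2 + α * q.1)) :=
  velocity_comp_affine (c := c) (t := q.2) hc

variable [IsManifold I ∞ N]

theorem velocityFst_velocitySnd_affineVariation [I.Boundaryless]
    (hc : SmoothNear 𝓘(ℝ, ℝ) I c t) :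
    velocityFst (velocitySnd (affineVariation c α β)) (0, t) =
      secondOrderCurve (I := I) c α β t := by
  -- `K` separates rescaling from time shift. The curve s ↦ ∂ₜF(s, t) is `K` along the line (βs, (α
  -- + βt)s), so the chain rule combines the partial derivatives E₁(c') and c'' of `K`.
  let K : ℝ × ℝ → TangentBundle I N := fun q => fiberSmul (1 + q.1) (velocity c (t + q.2))
  have hK : SmoothNear 𝓘(ℝ, ℝ × ℝ) I.tangent K 0 := by
    refine SmoothNear.fiberSmul (g := fun q : ℝ × ℝ => 1 + q.1)
      (ContMDiff.smoothNear (contDiff_const.add contDiff_fst).contMDiff)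
      (SmoothNear.comp (g := velocity c) (f := fun q : ℝ × ℝ => t + q.2) ?_
        (ContMDiff.smoothNear (contDiff_const.add contDiff_snd).contMDiff))
    simpa using hc.velocity
  have hK0 : K 0 = velocity c t := by
    have h1 : K 0 = fiberSmul (1 + 0) (velocity c (t + 0)) := rfl
    rw [h1, add_zero, add_zero]
    exact TotalSpace.ext rfl (heq_of_eq (one_smul ℝ _))
  let γ : ℝ → ℝ × ℝ := fun s => (β * s, (α + β * t) * s)
  have hγ : HasDerivAt γ (β, α + β * t) 0 := by
    simpa using ((hasDerivAt_id (0 : ℝ)).const_mul β).prodMk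
      ((hasDerivAt_id (0 : ℝ)).const_mul (α + β * t))
  have hγ0 : γ 0 = 0 := by simp [γ]
  have h1 : (fun s => velocitySnd (affineVariation c α β) (s, t)) =ᶠ[𝓝 0]
      fun s => K (γ s) := by
    have := eventually_slice_fst (q := (0, t)) (eventually_affine (α := α) (β := β) hc.eventually)
    filter_upwards [this] with s hs
    rw [velocitySnd_affineVariation hs.mdifferentiableAt]
    have : (1 + β * s) * t + α * s = t + (α + β * t) * s := by ring
    simp only [K, γ, this]
  have h2 : velocityFst (velocitySnd (I := I) (affineVariation c α β)) (0, t) =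
      tangentMap 𝓘(ℝ, ℝ × ℝ) I.tangent K ⟨0, (β, α + β * t)⟩ := by
    unfold velocityFst
    dsimp only
    rw [velocity_congr (I := I.tangent) h1, velocity_comp_curve (F := K) (γ := γ)
      (hγ0.symm ▸ hK.mdifferentiableAt) hγ, hγ0]
  have e1 : velocityFst (I := I.tangent) K 0 = (⟨velocity c t, liouville (velocity c t)⟩ : TT I N) := by
    rw [liouville_eq_velocity]
    unfold velocityFst
    simp only [K, Prod.fst_zero, Prod.snd_zero, add_zero]
    rfl
  have e2 : velocitySnd (I := I.tangent) K 0 = velocity (velocity (I := I) c) t := by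
    have h3 : (fun u => K (0, u)) = fun u => velocity c (u + t) := by
      funext u
      have h4 : K (0, u) = fiberSmul (1 + 0) (velocity c (t + u)) := rfl
      rw [h4, add_zero, add_comm t u]
      exact TotalSpace.ext rfl (heq_of_eq (one_smul ℝ _))
    have h5 : velocitySnd (I := I.tangent) K 0 = velocity (I := I.tangent) (fun u => K (0, u)) 0 := rfl
    rw [h5, h3, velocity_comp_add (I := I.tangent) (c := velocity c), zero_add]
    rw [zero_add]
    exact hc.velocity.mdifferentiableAt
  rw [velocityFst_eq_tangentMap hK.mdifferentiableAt] at e1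
  rw [velocitySnd_eq_tangentMap hK.mdifferentiableAt] at e2
  rw [h2]
  refine TotalSpace.ext hK0 (heq_of_eq ?_)
  let L : ℝ × ℝ →L[ℝ] E × E := mfderiv 𝓘(ℝ, ℝ × ℝ) I.tangent K 0
  have f1 : L (1, 0) = liouville (velocity c t) := congrArg (fun η : TT I N => (η.2 : E × E)) e1
  have f2 : L (0, 1) = (velocity (velocity (I := I) c) t).2 :=
    congrArg (fun η : TT I N => (η.2 : E × E)) e2
  have h3 : ((β, α + β * t) : ℝ × ℝ) = (α + β * t) • ((0 : ℝ), (1 : ℝ)) + β • ((1 : ℝ), (0 : ℝ)) := by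
    simp
  have h4 : L (β, α + β * t) = (α + β * t) • L (0, 1) + β • L (1, 0) := by
    rw [h3, map_add, map_smul, map_smul]
  rw [f1, f2] at h4
  exact h4

theorem eventually_velocityFst_velocitySnd_affineVariation [I.Boundaryless]
    (hc : SmoothNear 𝓘(ℝ, ℝ) I c t) :
    ∀ᶠ t' in 𝓝 t, velocityFst (velocitySnd (affineVariation c α β)) (0, t') =
      secondOrderCurve (I := I) c α β t' :=
  hc.eventually.mono fun _ h => velocityFst_velocitySnd_affineVariation h

theorem smoothNear_secondOrderCurve [I.Boundaryless]
    (hc : SmoothNear 𝓘(ℝ, ℝ) I c t) :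
    SmoothNear 𝓘(ℝ, ℝ) I.tangent.tangent (secondOrderCurve (I := I) c α β) t :=
  (smoothNear_affineVariation (α := α) (β := β) hc).velocitySnd.velocityFst.slice_snd.congr
    ((eventually_velocityFst_velocitySnd_affineVariation hc).mono fun _ h => h.symm)

theorem involution_velocity_parallelField [I.Boundaryless]
    (hc : SmoothNear 𝓘(ℝ, ℝ) I c t) :
    involution (velocity (parallelField (I := I) c α β) t) = secondOrderCurve c α β t := by
  have h : (fun t' => velocityFst (affineVariation c α β) (0, t')) =ᶠ[𝓝 t]
      parallelField (I := I) c α β :=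
    hc.eventually.mono fun _ h => velocityFst_affineVariation h.mdifferentiableAt
  rw [← velocity_congr (I := I.tangent) h, ← velocityFst_velocitySnd_affineVariation hc,
    ← involution_velocitySnd_velocityFst (smoothNear_affineVariation hc)]
  rfl

theorem secondOrderCurve_congr {c' : ℝ → N} (h : c =ᶠ[𝓝 t] c') :
    secondOrderCurve (I := I) c α β t = secondOrderCurve c' α β t := by
  have h1 : velocity (I := I) c =ᶠ[𝓝 t] velocity c' :=
    (eventually_eventually_nhds.2 h).mono fun _ h => velocity_congr h
  have h2 := velocity_congr (I := I.tangent) h1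
  -- The point c''(t) of `TTN` carries its base point c'(t), so one rewrite handles the dependent
  -- sum.
  have h3 (w w' : TT I N) (hw : w = w') :
      (⟨w.1, ((α + β * t) • w.2 + β • liouville w.1 : TangentSpace I.tangent w.1)⟩ : TT I N) =
        ⟨w'.1, ((α + β * t) • w'.2 + β • liouville w'.1 : TangentSpace I.tangent w'.1)⟩ := by
    rw [hw]
  exact h3 _ _ h2

/-- The coefficient is α + βt = (α − βb) + β(t + b), and velocities commute with translation. -/
theorem secondOrderCurve_comp_add {b : ℝ} (hc : SmoothNear 𝓘(ℝ, ℝ) I c (t + b)) :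
    secondOrderCurve (I := I) (fun t => c (t + b)) α β t =
      secondOrderCurve c (α - β * b) β (t + b) := by
  have hb : ∀ᶠ t' in 𝓝 t, SmoothNear 𝓘(ℝ, ℝ) I c (t' + b) :=
    ((continuous_id.add continuous_const).continuousAt (x := t)).eventually hc.eventually
  have h1 : velocity (I := I) (fun t => c (t + b)) =ᶠ[𝓝 t] fun t => velocity c (t + b) :=
    hb.mono fun _ h => velocity_comp_add h.mdifferentiableAt
  have h2 := velocity_congr (I := I.tangent) h1
  rw [velocity_comp_add (I := I.tangent) (c := velocity c) hc.velocity.mdifferentiableAt] at h2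
  have hcoef : α + β * t = α - β * b + β * (t + b) := by ring
  have h3 (w w' : TT I N) (hw : w = w') :
      (⟨w.1, ((α + β * t) • w.2 + β • liouville w.1 : TangentSpace I.tangent w.1)⟩ : TT I N) =
        ⟨w'.1, ((α - β * b + β * (t + b)) • w'.2 + β • liouville w'.1 :
          TangentSpace I.tangent w'.1)⟩ := by
    rw [hw, hcoef]
  exact h3 _ _ h2

/-- A curve with nonvanishing tangent and the constants are determined by the second order
curve. -/
theorem secondOrderCurve_injective [I.Boundaryless] {α' β' : ℝ} (hc : SmoothNear 𝓘(ℝ, ℝ) I c 0)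
    (hne : (velocity (I := I) c 0).2 ≠ 0)
    (h : secondOrderCurve (I := I) c α β 0 = secondOrderCurve c α' β' 0) : α = α' ∧ β = β' := by
  let ξ := velocity (I := I) c 0
  let v : E × E := (velocity (I := I.tangent) (velocity (I := I) c) 0).2
  let l : E × E := liouville ξ
  have hl : l = (0, (ξ.2 : E)) := liouville_eq ξ
  -- Dπ sends c'' to c' and kills the vertical E₁, isolating α. Then β is read off the vertical
  -- component.
  let L : E × E →L[ℝ] E := mfderiv I.tangent I (TotalSpace.proj : TangentBundle I N → N) ξ
  have hLv : L v = (ξ.2 : E) := by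
    have h1 := velocity_comp (f := (TotalSpace.proj : TangentBundle I N → N)) (I := I.tangent)
      (γ := velocity c) (t := 0) (mdifferentiable_tangentProj _) hc.velocity.mdifferentiableAt
    exact (congrArg (fun η : TangentBundle I N => (η.2 : E)) h1).symm
  have hLl : L l = 0 := by
    have h1 : (⟨ξ, liouville ξ⟩ : TT I N) = _ := liouville_eq_velocity ξ
    have h2 : MDifferentiableAt 𝓘(ℝ, ℝ) I.tangent (fun s : ℝ => fiberSmul (1 + s) ξ) 0 :=
      (SmoothNear.fiberSmul (g := fun s : ℝ => 1 + s) (G := fun _ : ℝ => ξ)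
        (ContMDiff.smoothNear (contDiff_const.add contDiff_id).contMDiff)
        (ContMDiff.smoothNear contMDiff_const)).mdifferentiableAt
    have h3 := velocity_comp (f := (TotalSpace.proj : TangentBundle I N → N))
      (I := I.tangent) (γ := fun s : ℝ => fiberSmul (1 + s) ξ) (t := 0) (mdifferentiable_tangentProj _) h2
    have h4 : velocity (I := I) (fun s : ℝ => (fiberSmul (1 + s) ξ).1) 0 = ⟨ξ.1, 0⟩ := by
      unfold velocity
      refine TotalSpace.ext rfl (heq_of_eq ?_)
      have : mfderiv 𝓘(ℝ, ℝ) I (fun _ : ℝ => ξ.1) 0 = 0 := mfderiv_const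
      exact congrArg (fun A : ℝ →L[ℝ] E => A 1) this
    have h5 : tangentMap I.tangent I (TotalSpace.proj : TangentBundle I N → N)
        (⟨ξ, liouville ξ⟩ : TT I N) = ⟨ξ.1, 0⟩ := by
      rw [h1]; exact h3.symm.trans h4
    exact congrArg (fun η : TangentBundle I N => (η.2 : E)) h5
  have h1 : (α + β * 0) • v + β • l = (α' + β' * 0) • v + β' • l :=
    congrArg (fun η : TT I N => (η.2 : E × E)) h
  simp only [mul_zero, add_zero] at h1
  have h2 := congrArg L h1
  simp only [map_add, map_smul, hLv, hLl, smul_zero, add_zero] at h2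
  have hα : α = α' := smul_left_injective ℝ hne h2
  refine ⟨hα, ?_⟩
  rw [hα, add_right_inj, hl] at h1
  exact smul_left_injective ℝ hne (congrArg Prod.snd h1)

end SecondOrder

/-! ### Geodesics of S and of Sᶜᶜ. -/

section Geodesics

variable {E : Type*} [NormedAddCommGroup E] [NormedSpace ℝ E]
  {H : Type*} [TopologicalSpace H] {I : ModelWithCorners ℝ E H}
  {N : Type*} [TopologicalSpace N] [ChartedSpace H N] [IsManifold I ∞ N]

theorem contMDiff_projTT : ContMDiff I.tangent.tangent I ∞ (projTT (I := I) (N := N)) :=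
  contMDiff_tangentProj.comp contMDiff_tangentProj

theorem tangentMap_projTT (ζ : TTT I N) :
    tangentMap I.tangent.tangent I projTT ζ =
      tangentMap I.tangent I TotalSpace.proj
        (tangentMap I.tangent.tangent I.tangent (TotalSpace.proj : TT I N → TangentBundle I N) ζ) :=
  tangentMap_comp_at ζ (mdifferentiable_tangentProj _) (mdifferentiable_tangentProj _)

theorem velocity_projTT {γ : ℝ → TT I N} {t : ℝ}
    (hγ : MDifferentiableAt 𝓘(ℝ, ℝ) I.tangent.tangent γ t) :
    velocity (fun t => projTT (γ t)) t = tangentMap I.tangent.tangent I projTT (velocity γ t) :=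
  velocity_comp (contMDiff_projTT.mdifferentiable (by simp) _) hγ

/-- `S` is a smooth vector field near `ξ`. -/
def SmoothFieldNear (S : TangentBundle I N → TT I N) (ξ : TangentBundle I N) : Prop :=
  SmoothNear I.tangent I.tangent.tangent S ξ ∧ ∀ᶠ η in 𝓝 ξ, (S η).1 = η

/-- Smoothness and the section property pass to the lift together, so the lemma can be applied
twice. -/
theorem SmoothFieldNear.completeLift [I.Boundaryless] {S : TangentBundle I N → TT I N} {ξ : TT I N}
    (h : SmoothFieldNear S (tangentMap I.tangent I TotalSpace.proj ξ)) :
    SmoothFieldNear (SprayGeometry.completeLift S) ξ := by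
  refine ⟨smoothNear_completeLift h.1, ?_⟩
  have hc : ContinuousAt (tangentMap I.tangent I (TotalSpace.proj : TangentBundle I N → N)) ξ :=
    (SmoothNear.tangentMap
      (ContMDiff.smoothNear contMDiff_tangentProj)).contMDiffAt.continuousAt
  filter_upwards [hc.eventually (h.1.eventually.and (eventually_eventually_nhds.2 h.2))]
    with η hη
  exact completeLift_proj hη.1.mdifferentiableAt hη.2

theorem Spray.smoothFieldNear [T2Space N] (S : Spray I N) {ξ : TangentBundle I N} (hξ : ξ.2 ≠ 0) :
    SmoothFieldNear S.toMap ξ :=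
  ⟨S.smoothNear (mem_slashed_id.2 hξ), Eventually.of_forall fun _ => rfl⟩

theorem Spray.smoothFieldNear_completeLift_completeLift [I.Boundaryless] [T2Space N]
    (S : Spray I N) {ζ : TTT I N}
    (hζ : ζ ∈ slashed I I.tangent.tangent (projTT (I := I) (N := N))) :
    SmoothFieldNear (completeLift (completeLift S.toMap)) ζ := by
  refine SmoothFieldNear.completeLift (SmoothFieldNear.completeLift (S.smoothFieldNear ?_))
  rw [← tangentMap_projTT]
  exact hζ

variable {S : Spray I N} {s : Set ℝ} {c : ℝ → N}

theorem Spray.Geodesic.smoothNear (hc : S.Geodesic s c) (hs : IsOpen s) {t : ℝ} (ht : t ∈ s) :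
    SmoothNear 𝓘(ℝ, ℝ) I c t :=
  ContMDiffOn.smoothNear (IsGeodesic.smooth hc) hs ht

theorem Spray.Geodesic.velocity_ne_zero (hc : S.Geodesic s c) {t : ℝ} (ht : t ∈ s) :
    (velocity (I := I) c t).2 ≠ 0 :=
  mem_slashed_id.1 (IsGeodesic.regular hc t ht)

theorem Spray.Geodesic.mono (hc : S.Geodesic s c) {s' : Set ℝ} (h : s' ⊆ s) : S.Geodesic s' c :=
  ⟨(IsGeodesic.smooth hc).mono h, fun t ht => IsGeodesic.regular hc t (h ht),
    fun t ht => IsGeodesic.equation hc t (h ht)⟩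

theorem Spray.Geodesic.comp_add (hc : S.Geodesic s c) (hs : IsOpen s) (b : ℝ) :
    S.Geodesic ((fun t => t + b) ⁻¹' s) (fun t => c (t + b)) := by
  have hv (t) (ht : t + b ∈ s) : velocity (I := I) (fun t => c (t + b)) t = velocity c (t + b) :=
    velocity_comp_add (hc.smoothNear hs ht).mdifferentiableAt
  have hcont : Continuous fun t : ℝ => t + b := by fun_prop
  refine ⟨?_, fun t ht => ?_, fun t ht => ?_⟩
  · exact (IsGeodesic.smooth hc).comp (contDiff_id.add contDiff_const).contMDiff.contMDiffOn
      (fun t ht => ht)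
  · rw [hv t ht]
    exact IsGeodesic.regular hc _ ht
  · have h1 : velocity (I := I) (fun t => c (t + b)) =ᶠ[𝓝 t] fun t => velocity c (t + b) := by
      filter_upwards [(hs.preimage hcont).mem_nhds ht] with t' ht'
      exact hv t' ht'
    rw [velocity_congr h1, hv t ht, velocity_comp_add (I := I.tangent) (c := velocity c)
      (hc.smoothNear hs ht).velocity.mdifferentiableAt]
    exact IsGeodesic.equation hc _ ht

/-- Positive affine reparametrisations of a geodesic of a spray are geodesics. -/
theorem Spray.Geodesic.affineVariation [I.Boundaryless] [T2Space N] (hc : S.Geodesic s c) (hs : IsOpen s) {α β : ℝ}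
    {q : ℝ × ℝ} (hq : (1 + β * q.1) * q.2 + α * q.1 ∈ s) (hpos : 0 < 1 + β * q.1) :
    velocitySnd (velocitySnd (affineVariation c α β)) q =
      S.toMap (velocitySnd (affineVariation c α β) q) := by
  have hcont : Continuous fun t : ℝ => (1 + β * q.1) * t + α * q.1 := by fun_prop
  have h1 : (fun t => velocitySnd (I := I) (SprayGeometry.affineVariation c α β) (q.1, t)) =ᶠ[𝓝 q.2]
      fun t => fiberSmul (1 + β * q.1) (velocity c ((1 + β * q.1) * t + α * q.1)) := by
    filter_upwards [(hs.preimage hcont).mem_nhds hq] with t ht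
    exact velocitySnd_affineVariation (q := (q.1, t)) (hc.smoothNear hs ht).mdifferentiableAt
  have hv := (hc.smoothNear hs hq).velocity
  have h2 := velocity_comp_affine (I := I.tangent) (c := velocity c) hv.mdifferentiableAt
  have hmd : MDifferentiableAt 𝓘(ℝ, ℝ) I.tangent
      (fun t => velocity c ((1 + β * q.1) * t + α * q.1)) q.2 :=
    (SmoothNear.comp (g := velocity c) (f := fun t : ℝ => (1 + β * q.1) * t + α * q.1) hv
      (ContMDiff.smoothNear (ContDiff.contMDiff (by fun_prop)))).mdifferentiableAt
  have h3 : velocitySnd (I := I.tangent) (velocitySnd (SprayGeometry.affineVariation c α β)) q =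
      velocity (fun t => fiberSmul (1 + β * q.1) (velocity c ((1 + β * q.1) * t + α * q.1))) q.2 :=
    velocity_congr h1
  have h4 : velocitySnd (I := I) (SprayGeometry.affineVariation c α β) q =
      fiberSmul (1 + β * q.1) (velocity c ((1 + β * q.1) * q.2 + α * q.1)) := h1.self_of_nhds
  -- With r = 1 + βs, the inner derivative contributes the factor r and the outer scaling the
  -- differential of `fiberSmul r`; homogeneity says that S transforms in the same way.
  rw [h3, h4, S.toMap_fiberSmul (hc.velocity_ne_zero hq) hpos,
    velocity_comp (smoothNear_fiberSmul _ _).mdifferentiableAt hmd, h2,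
    IsGeodesic.equation hc _ hq]
  rfl

/-- The second order curves of a geodesic are geodesics of the iterated complete lift. -/
theorem Spray.Geodesic.secondOrderCurve [I.Boundaryless] [T2Space N] (hc : S.Geodesic s c) (hs : IsOpen s) (α β : ℝ) :
    IsGeodesic I projTT (completeLift (completeLift S.toMap)) s
      (secondOrderCurve (I := I) c α β) := by
  refine ⟨fun t ht => (smoothNear_secondOrderCurve
    (hc.smoothNear hs ht)).contMDiffAt.contMDiffWithinAt, fun t ht => ?_, fun t ht => ?_⟩
  · have h1 := velocity_projTT
      (smoothNear_secondOrderCurve (α := α) (β := β) (hc.smoothNear hs ht)).mdifferentiableAt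
    have h2 := hc.velocity_ne_zero ht
    change (tangentMap I.tangent.tangent I projTT _).2 ≠ 0
    rw [← h1]
    exact h2
  · let F := SprayGeometry.affineVariation c α β
    let q : ℝ × ℝ := (0, t)
    have hF : SmoothNear 𝓘(ℝ, ℝ × ℝ) I F q := smoothNear_affineVariation (hc.smoothNear hs ht)
    -- Only the germ at s = 0 matters, and there the rescaling is positive.
    have hpos : ∀ᶠ q' : ℝ × ℝ in 𝓝 q, 0 < 1 + β * q'.1 := by
      have hcont : Continuous fun q' : ℝ × ℝ => 1 + β * q'.1 := by fun_prop
      refine hcont.continuousAt.eventually (lt_mem_nhds ?_)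
      simp [q]
    have hgeo : ∀ᶠ q' in 𝓝 q, (SmoothFieldNear S.toMap (velocitySnd F q')) ∧
        velocitySnd (velocitySnd F) q' = S.toMap (velocitySnd F q') := by
      filter_upwards [hpos, eventually_affine (α := α) (β := β) (hs.mem_nhds ht)] with q' h1 h2
      refine ⟨S.smoothFieldNear ?_, hc.affineVariation hs h2 h1⟩
      rw [velocitySnd_affineVariation (hc.smoothNear hs h2).mdifferentiableAt]
      exact smul_ne_zero h1.ne' (hc.velocity_ne_zero h2)
    have hlift : ∀ᶠ q' in 𝓝 q, velocitySnd (velocitySnd (velocitySnd F)) q' =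
        completeLift S.toMap (velocitySnd (velocitySnd F) q') := by
      filter_upwards [hF.eventually, eventually_eventually_nhds.2 hgeo] with q' h1 h2
      exact velocity_velocity_velocity h1.slice_snd h2.self_of_nhds.1.1.mdifferentiableAt
        ((eventually_slice_snd h2).mono fun _ h => h.2)
    have hproj : tangentMap I.tangent I TotalSpace.proj (velocitySnd (velocitySnd F) q) =
        velocitySnd F q :=
      (velocitySnd_comp (f := (TotalSpace.proj : TangentBundle I N → N))
        (mdifferentiable_tangentProj _) hF.velocitySnd).symm
    have hS : SmoothFieldNear (completeLift S.toMap) (velocitySnd (velocitySnd F) q) :=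
      SmoothFieldNear.completeLift (hproj ▸ hgeo.self_of_nhds.1)
    -- ∂ₜF is a family of Sᶜ-geodesics, so its variation field ∂ₛ∂ₜF is a geodesic of the lift of
    -- Sᶜ.
    have h1 := velocitySnd_velocitySnd_velocityFst hF.velocitySnd hS.1.mdifferentiableAt hlift
    have h2 := eventually_velocityFst_velocitySnd_affineVariation (α := α) (β := β)
      (hc.smoothNear hs ht)
    have h3 : ∀ᶠ t' in 𝓝 t, velocitySnd (I := I.tangent.tangent) (velocityFst (velocitySnd F)) (0, t') =
        velocity (SprayGeometry.secondOrderCurve (I := I) c α β) t' :=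
      (eventually_eventually_nhds.2 h2).mono fun _ h => velocity_congr h
    have h4 : velocitySnd (I := I.tangent.tangent.tangent)
        (velocitySnd (I := I.tangent.tangent) (velocityFst (velocitySnd F))) q =
        velocity (velocity (SprayGeometry.secondOrderCurve (I := I) c α β)) t := velocity_congr h3
    rw [← h4, ← h3.self_of_nhds]
    exact h1

/-- Geodesics of the iterated complete lift project to geodesics of the spray. -/
theorem Spray.geodesic_projTT [I.Boundaryless] {γ : ℝ → TT I N} (hs : IsOpen s)
    (hγ : IsGeodesic I projTT (completeLift (completeLift S.toMap)) s γ) :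
    S.Geodesic s (fun t => projTT (γ t)) := by
  have hsm (t) (ht : t ∈ s) := ContMDiffOn.smoothNear hγ.smooth hs ht
  refine ⟨contMDiff_projTT.comp_contMDiffOn hγ.smooth, fun t ht => ?_, fun t ht => ?_⟩
  · rw [mem_slashed_id, velocity_projTT (hsm t ht).mdifferentiableAt]
    exact hγ.regular t ht
  -- Two projections: from Sᶜᶜ to Sᶜ along `TTN → TN`, then from Sᶜ to S along `TN → N`.
  · refine velocity_velocity_proj (J := fun t => (γ t).1) ?_ ?_
    · exact SmoothNear.comp (ContMDiff.smoothNear contMDiff_tangentProj) (hsm t ht)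
    · exact velocity_velocity_proj (hsm t ht) (hγ.equation t ht)

end Geodesics

/-! ### Geodesics in P are the second order curves. -/

section Characterization

variable {E : Type*} [NormedAddCommGroup E] [NormedSpace ℝ E]
  {H : Type*} [TopologicalSpace H] {I : ModelWithCorners ℝ E H}
  {N : Type*} [TopologicalSpace N] [ChartedSpace H N] [IsManifold I ∞ N] [I.Boundaryless]
  {S : Spray I N} {s : Set ℝ} {γ : ℝ → TT I N} {J : ℝ → TangentBundle I N} {c : ℝ → N} {α β : ℝ}

theorem Spray.Geodesic.involution_velocity (hc : S.Geodesic s c) (hs : IsOpen s)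
    (hJ : ∀ t ∈ s, J t = parallelField c α β t) {t : ℝ} (ht : t ∈ s) :
    involution (velocity J t) = SprayGeometry.secondOrderCurve (I := I) c α β t := by
  rw [velocity_congr (I := I.tangent) (mem_of_superset (hs.mem_nhds ht) hJ),
    involution_velocity_parallelField (hc.smoothNear hs ht)]

theorem Spray.secondOrderCurve_unique {c₁ c₂ : ℝ → N} {α₁ β₁ α₂ β₂ : ℝ}
    (hs : IsOpen s) (h0 : (0 : ℝ) ∈ s) (hc₁ : S.Geodesic s c₁)
    (h₁ : ∀ t ∈ s, γ t = secondOrderCurve c₁ α₁ β₁ t)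
    (h₂ : ∀ t ∈ s, γ t = secondOrderCurve c₂ α₂ β₂ t) :
    EqOn c₁ c₂ s ∧ α₁ = α₂ ∧ β₁ = β₂ := by
  have heq : EqOn c₁ c₂ s := fun t ht =>
    congrArg (fun ξ : TT I N => ξ.1.1) ((h₁ t ht).symm.trans (h₂ t ht))
  have h := (h₁ 0 h0).symm.trans (h₂ 0 h0)
  rw [← secondOrderCurve_congr (c := c₁) (mem_of_superset (hs.mem_nhds h0) heq)] at h
  exact ⟨heq, secondOrderCurve_injective (hc₁.smoothNear hs h0) (hc₁.velocity_ne_zero h0) h⟩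

variable [T2Space N]

theorem Spray.Geodesic.isGeodesicInP (hc : S.Geodesic s c) (hs : IsOpen s) (h0 : (0 : ℝ) ∈ s)
    (h : ∀ t ∈ s, γ t = SprayGeometry.secondOrderCurve c α β t) : S.IsGeodesicInP s γ := by
  have hg := hc.secondOrderCurve hs α β
  have hev (t) (ht : t ∈ s) : γ =ᶠ[𝓝 t] SprayGeometry.secondOrderCurve c α β :=
    mem_of_superset (hs.mem_nhds ht) h
  have hv (t) (ht : t ∈ s) : velocity (I := I.tangent.tangent) γ t =
      velocity (SprayGeometry.secondOrderCurve c α β) t := velocity_congr (hev t ht)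
  refine ⟨⟨hg.smooth.congr h, fun t ht => ?_, fun t ht => ?_⟩, 0, h0, ?_⟩
  · rw [hv t ht]
    exact hg.regular t ht
  · rw [velocity_congr (I := I.tangent.tangent.tangent) (mem_of_superset (hs.mem_nhds ht) hv),
      hv t ht]
    exact hg.equation t ht
  · obtain ⟨ε, hε, hsub⟩ := Metric.isOpen_iff.1 hs 0 h0
    rw [Real.ball_eq_Ioo, zero_sub, zero_add] at hsub
    -- Membership in Δ is witnessed at time 0 by the parallel Jacobi field along c restricted to a
    -- small interval.
    refine ⟨ε, hε, parallelField c α β, ⟨α, β, c, hc.mono hsub, fun t _ => rfl⟩, ?_⟩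
    refine velocity_congr (mem_of_superset (hs.mem_nhds h0) fun t ht => ?_)
    exact (h t ht).trans (involution_velocity_parallelField (hc.smoothNear hs ht)).symm

theorem Spray.exists_geodesic_of_isGeodesicInP (hs : IsOpen s) (hs' : s.OrdConnected)
    (hγ : S.IsGeodesicInP s γ) : ∃ (c : ℝ → N) (α β : ℝ), S.Geodesic s c ∧
      ∀ t ∈ s, γ t = secondOrderCurve c α β t := by
  obtain ⟨hgeo, t₀, ht₀, ε, hε, J, ⟨α, β, b, hb, hJ⟩, hvel⟩ := hγ
  have h0 : (0 : ℝ) ∈ Ioo (-ε) ε := ⟨neg_lt_zero.2 hε, hε⟩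
  have hJ' : (fun t => involution (velocity J t)) =ᶠ[𝓝 0] secondOrderCurve (I := I) b α β :=
    mem_of_superset (isOpen_Ioo.mem_nhds h0) fun t ht =>
      hb.involution_velocity isOpen_Ioo hJ ht
  rw [velocity_congr (I := I.tangent.tangent) hJ'] at hvel
  have hb0 := hb.smoothNear isOpen_Ioo h0
  have hmd := (smoothNear_secondOrderCurve (α := α) (β := β) hb0).mdifferentiableAt
  let c : ℝ → N := fun t => projTT (γ t)
  have hc : S.Geodesic s c := Spray.geodesic_projTT hs hgeo
  have hγt₀ := (ContMDiffOn.smoothNear hgeo.smooth hs ht₀).mdifferentiableAt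
  -- The element of Δ is a velocity at time 0 and equals γ'(t₀), so b is delayed by t₀.
  let b' : ℝ → N := fun t => b (t + -t₀)
  have hb' := hb.comp_add isOpen_Ioo (-t₀)
  let s' : Set ℝ := s ∩ (fun t => t + -t₀) ⁻¹' Ioo (-ε) ε
  have hcont : Continuous fun t : ℝ => t + -t₀ := by fun_prop
  have hs'o : IsOpen s' := hs.inter (isOpen_Ioo.preimage hcont)
  have hs'c : IsPreconnected s' := by
    have : ((fun t : ℝ => t + -t₀) ⁻¹' Ioo (-ε) ε).OrdConnected :=
      ordConnected_Ioo.preimage_mono fun x y h => by linarith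
    exact (hs'.inter this).isPreconnected
  have ht₀' : t₀ ∈ s' := ⟨ht₀, by simpa using hε⟩
  have hinit : velocity (I := I) c t₀ = velocity b' t₀ := by
    have h1 : velocity (I := I) b' t₀ = velocity b 0 := by
      have := velocity_comp_add (I := I) (c := b) (b := -t₀) (t := t₀)
        (by rw [add_neg_cancel]; exact hb0.mdifferentiableAt)
      rwa [add_neg_cancel] at this
    rw [h1]
    refine (velocity_projTT hγt₀).trans ?_
    rw [hvel]
    exact (velocity_projTT hmd).symm
  have hbase : ∀ t ∈ s', velocity (I := I) c t = velocity b' t :=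
    eqOn_velocity_of_eq (U := slashed I I id) hs'o hs'c
      (fun ξ hξ => (S.smoothFieldNear (mem_slashed_id.1 hξ)).1)
      (fun ξ hξ => (S.smoothFieldNear (mem_slashed_id.1 hξ)).2)
      ((IsGeodesic.smooth hc).mono inter_subset_left)
      ((IsGeodesic.smooth hb').mono inter_subset_right)
      (fun t ht => IsGeodesic.regular hc t ht.1) (fun t ht => IsGeodesic.equation hc t ht.1)
      (fun t ht => IsGeodesic.equation hb' t ht.2) ht₀' hinit
  have hcb : ∀ t ∈ s', c t = b' t := fun t ht => congrArg TotalSpace.proj (hbase t ht)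
  -- The delay replaces α + βt by α + β(t − t₀), whence the new constant α − βt₀.
  have hcurve : secondOrderCurve (I := I) c (α - β * t₀) β =ᶠ[𝓝 t₀]
      fun t => secondOrderCurve b α β (t + -t₀) := by
    filter_upwards [hs'o.mem_nhds ht₀'] with t ht
    rw [secondOrderCurve_congr (mem_of_superset (hs'o.mem_nhds ht) hcb),
      secondOrderCurve_comp_add (hb.smoothNear isOpen_Ioo ht.2)]
    congr 1
    ring
  have hvel' : velocity (I := I.tangent.tangent) γ t₀ =
      velocity (secondOrderCurve c (α - β * t₀) β) t₀ := by
    rw [velocity_congr (I := I.tangent.tangent) hcurve, hvel]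
    have := velocity_comp_add (I := I.tangent.tangent) (c := secondOrderCurve (I := I) b α β)
      (b := -t₀) (t := t₀) (by rw [add_neg_cancel]; exact hmd)
    rw [this, add_neg_cancel]
  have hsoc := hc.secondOrderCurve hs (α - β * t₀) β
  -- As c lives on all of `s`, its second order curve does too, and one common velocity at t₀
  -- suffices.
  have hall := eqOn_velocity_of_eq (U := slashed I I.tangent.tangent projTT) hs
    hs'.isPreconnected
    (fun ξ hξ => (S.smoothFieldNear_completeLift_completeLift hξ).1)
    (fun ξ hξ => (S.smoothFieldNear_completeLift_completeLift hξ).2)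
    hgeo.smooth hsoc.smooth hgeo.regular hgeo.equation hsoc.equation ht₀ hvel'
  exact ⟨c, _, _, hc, fun t ht => congrArg TotalSpace.proj (hall t ht)⟩

end Characterization

end SprayGeometry

end

/-! ### The proposition. -/

theorem mainTheorem2 (n : ℕ) (M : Type*) [TopologicalSpace M]
    [ChartedSpace (EuclideanSpace ℝ (Fin n)) M] [IsManifold (𝓡 n) ∞ M]
    [T2Space M] [SecondCountableTopology M]
    (S : SprayGeometry.Spray (𝓡 n) M)
    (s : Set ℝ) (hs_open : IsOpen s) (hs_interval : s.OrdConnected) (hs_zero : (0 : ℝ) ∈ s)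
    (γ : ℝ → SprayGeometry.TT (𝓡 n) M)
    (hγ : ContMDiffOn 𝓘(ℝ, ℝ) (𝓡 n).tangent.tangent ∞ γ s) :
    -- equivalence of the three conditions
    List.TFAE [
      S.IsGeodesicInP s γ,
      ∃ J : ℝ → TangentBundle (𝓡 n) M, S.IsParallelJacobiField s J ∧
        ∀ t ∈ s, γ t = SprayGeometry.involution (SprayGeometry.velocity J t),
      ∃ (c : ℝ → M) (α β : ℝ), S.Geodesic s c ∧
        ∀ t ∈ s, γ t = SprayGeometry.secondOrderCurve c α β t] ∧
    -- uniqueness of the parallel Jacobi field in the second condition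
    (∀ J₁ J₂ : ℝ → TangentBundle (𝓡 n) M,
      S.IsParallelJacobiField s J₁ → S.IsParallelJacobiField s J₂ →
      (∀ t ∈ s, γ t = SprayGeometry.involution (SprayGeometry.velocity J₁ t)) →
      (∀ t ∈ s, γ t = SprayGeometry.involution (SprayGeometry.velocity J₂ t)) →
      Set.EqOn J₁ J₂ s) ∧
    -- uniqueness of the data of that Jacobi field
    (∀ (c₁ c₂ : ℝ → M) (α₁ β₁ α₂ β₂ : ℝ), S.Geodesic s c₁ → S.Geodesic s c₂ →
      (∀ t ∈ s, γ t = SprayGeometry.involution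
        (SprayGeometry.velocity (SprayGeometry.parallelField c₁ α₁ β₁) t)) →
      (∀ t ∈ s, γ t = SprayGeometry.involution
        (SprayGeometry.velocity (SprayGeometry.parallelField c₂ α₂ β₂) t)) →
      Set.EqOn c₁ c₂ s ∧ α₁ = α₂ ∧ β₁ = β₂) ∧
    -- uniqueness of the data in the third condition
    (∀ (c₁ c₂ : ℝ → M) (α₁ β₁ α₂ β₂ : ℝ), S.Geodesic s c₁ → S.Geodesic s c₂ →
      (∀ t ∈ s, γ t = SprayGeometry.secondOrderCurve c₁ α₁ β₁ t) →
      (∀ t ∈ s, γ t = SprayGeometry.secondOrderCurve c₂ α₂ β₂ t) →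
      Set.EqOn c₁ c₂ s ∧ α₁ = α₂ ∧ β₁ = β₂) := by
  have h13 : S.IsGeodesicInP s γ ↔ ∃ (c : ℝ → M) (α β : ℝ), S.Geodesic s c ∧
      ∀ t ∈ s, γ t = SprayGeometry.secondOrderCurve c α β t :=
    ⟨SprayGeometry.Spray.exists_geodesic_of_isGeodesicInP hs_open hs_interval,
      fun ⟨_, _, _, hc, h⟩ => hc.isGeodesicInP hs_open hs_zero h⟩
  have h23 : (∃ J : ℝ → TangentBundle (𝓡 n) M, S.IsParallelJacobiField s J ∧
      ∀ t ∈ s, γ t = SprayGeometry.involution (SprayGeometry.velocity J t)) ↔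
      ∃ (c : ℝ → M) (α β : ℝ), S.Geodesic s c ∧
        ∀ t ∈ s, γ t = SprayGeometry.secondOrderCurve c α β t := by
    constructor
    · rintro ⟨J, ⟨α, β, c, hc, hJ⟩, h⟩
      exact ⟨c, α, β, hc, fun t ht => (h t ht).trans (hc.involution_velocity hs_open hJ ht)⟩
    · rintro ⟨c, α, β, hc, h⟩
      exact ⟨SprayGeometry.parallelField c α β, ⟨α, β, c, hc, fun _ _ => rfl⟩, fun t ht =>
        (h t ht).trans (hc.involution_velocity hs_open (fun _ _ => rfl) ht).symm⟩
  refine ⟨?_, ?_, ?_, ?_⟩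
  · rw [h23, h13]
    tfae_finish
  · rintro J₁ J₂ ⟨α₁, β₁, c₁, hc₁, hJ₁⟩ ⟨α₂, β₂, c₂, hc₂, hJ₂⟩ h₁ h₂ t ht
    obtain ⟨hc, rfl, rfl⟩ := SprayGeometry.Spray.secondOrderCurve_unique hs_open hs_zero hc₁
      (fun t ht => (h₁ t ht).trans (hc₁.involution_velocity hs_open hJ₁ ht))
      (fun t ht => (h₂ t ht).trans (hc₂.involution_velocity hs_open hJ₂ ht))
    -- Agreement of the geodesics on an open set gives agreement of their tangents, hence of the
    -- fields.
    have hv : SprayGeometry.velocity (I := 𝓡 n) c₁ t = SprayGeometry.velocity c₂ t :=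
      SprayGeometry.velocity_congr (Filter.mem_of_superset (hs_open.mem_nhds ht) hc)
    rw [hJ₁ t ht, hJ₂ t ht]
    exact congrArg (fun ξ : TangentBundle (𝓡 n) M =>
      (⟨ξ.1, α₁ • ξ.2 + (β₁ * t) • ξ.2⟩ : TangentBundle (𝓡 n) M)) hv
  · intro c₁ c₂ α₁ β₁ α₂ β₂ hc₁ hc₂ h₁ h₂
    exact SprayGeometry.Spray.secondOrderCurve_unique hs_open hs_zero hc₁
      (fun t ht => (h₁ t ht).trans (hc₁.involution_velocity hs_open (fun _ _ => rfl) ht))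
      (fun t ht => (h₂ t ht).trans (hc₂.involution_velocity hs_open (fun _ _ => rfl) ht))
  · intro c₁ c₂ α₁ β₁ α₂ β₂ hc₁ _ h₁ h₂
    exact SprayGeometry.Spray.secondOrderCurve_unique hs_open hs_zero hc₁ h₁ h₂
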